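/- Write $\mathbb D=\{|\lambda|<1\}$ and $\mathbb D_e=\{\lambda\in\mathbb C:|\lambda|>1\}$. All Hilbert spaces are complex; $\mathbf B(X,Y)$ denotes the bounded everywhere defined operators, and operators are identified with their graphs. For a linear relation (subspace) $T\subseteq X\times Y$ put $T^{-1}=\{\{g,f\}:\{f,g\}\in T\}$, $\ker T=\{f:\{f,0\}\in T\}$ and $T^{*}=\{\{h,k\}\in Y\times X:(k,f)=(h,g)\text{ for all }\{f,g\}\in T\}$. Let $\mathfrak H$, $\mathfrak L_1$, $\mathfrak L_2$ be Hilbert spaces, $\mathfrak L=\mathfrak L_1\times\mathfrak L_2$, and let $V$ be a closed isometric operator in $\mathfrak H$ (single-valued, defined on a linear subspace). A pair $(\mathfrak L,\Gamma)$ with a linear relation $\Gamma\subseteq\mathfrak H^2\times\mathfrak L$ is a *unitary boundary pair for $V$* if $V=\ker\Gamma$; the identity $$(f,g)_{\mathfrak H}-(f',g')_{\mathfrak H}=(u_1,v_1)_{\mathfrak L_1}-(u_2,v_2)_{\mathfrak L_2}\qquad(\ast)$$ holds for all $\{(f,f'),(u_1,u_2)\},\{(g,g'),(v_1,v_2)\}\in\Gamma$;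 and every $\{(g,g'),(v_1,v_2)\}\in\mathfrak H^2\times\mathfrak L$ that satisfies $(\ast)$ for all $\{(f,f'),(u_1,u_2)\}\in\Gamma$ belongs to $\Gamma$. Let $$V_1=\{\{f,f'\}:\exists u_2,\ \{(f,f'),(0,u_2)\}\in\Gamma\},\qquad V_2=\{\{f,f'\}:\exists u_1,\ \{(f,f'),(u_1,0)\}\in\Gamma\}.$$ The $\gamma$-fields and the Weyl family of $(\mathfrak L,\Gamma)$ are $$\gamma_1(\lambda)=\{\{u_1,f\}:\exists u_2,\ \{(f,\lambda f),(u_1,u_2)\}\in\Gamma\},\qquad \gamma_2(\lambda)=\{\{u_2,f\}:\exists u_1,\ \{(f,\lambda f),(u_1,u_2)\}\in\Gamma\},$$ $$\Theta(\lambda)=\{\{u_1,u_2\}:\exists f,\ \{(f,\lambda f),(u_1,u_2)\}\in\Gamma\}.$$ The Schur class $\mathcal S(\mathfrak L_1,\mathfrak L_2)$ consists of the holomorphic functions $s:\mathbb D\to\mathbf B(\mathfrak L_1,\mathfrak L_2)$ with $\|s(\lambda)\|\le1$ for all $\lambda\in\mathbb D$. The operator $V$ is *simple* if it has no eigenvalues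 off the unit circle and the subspaces $\mathfrak N_\lambda=\mathfrak H\ominus\operatorname{ran}(I-\bar\lambda V)$, $\lambda\in\mathbb D\cup\mathbb D_e$, span a dense subspace of $\mathfrak H$. **Theorem.** Let $(\mathfrak L,\Gamma)$ be a unitary boundary pair for a closed isometric operator $V$ in a Hilbert space $\mathfrak H$. Then: 1. $V_1^{-1}$ and $V_2$ are contractive operators in $\mathbf B(\mathfrak H)$ and $V_2=(V_1^{-1})^{*}$. 2. For $\lambda\in\mathbb D$, $\gamma_1(\lambda)$ is an operator in $\mathbf B(\mathfrak L_1,\mathfrak H)$, $\gamma_1$ is holomorphic on $\mathbb D$, $(V_1-\lambda I)^{-1}\in\mathbf B(\mathfrak H)$, and $\gamma_1(\lambda)=\gamma_1(\mu)+(\lambda-\mu)(V_1-\lambda I)^{-1}\gamma_1(\mu)$ for all $\lambda,\mu\in\mathbb D$. 3. For $\lambda\in\mathbb D_e$, $\gamma_2(\lambda)$ is an operator in $\mathbf B(\mathfrak L_2,\mathfrak H)$, $\gamma_2$ is holomorphic on $\mathbb D_e$, $(V_2-\lambda I)^{-1}\in\mathbf B(\mathfrak H)$, and $\gamma_2(\lambda)=\gamma_2(\mu)+(\lambda-\mu)(V_2-\lambda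 I)^{-1}\gamma_2(\mu)$ for all $\lambda,\mu\in\mathbb D_e$. 4. For $\lambda\in\mathbb D$, $\Theta(\lambda)$ is an operator in $\mathbf B(\mathfrak L_1,\mathfrak L_2)$, and the Weyl function $\Theta$ belongs to the Schur class $\mathcal S(\mathfrak L_1,\mathfrak L_2)$; moreover, the kernel $\mathsf K_\omega^\Theta(\lambda)=\dfrac{I-\Theta(\lambda)\Theta(\omega)^*}{1-\lambda\bar\omega}$ is nonnegative on $\mathbb D$, i.e. the matrices $\big((\mathsf K^\Theta_{\omega_j}(\omega_i)f_j,f_i)\big)_{i,j=1}^n$ are positive semidefinite for all $\omega_1,\dots,\omega_n\in\mathbb D$, $f_1,\dots,f_n\in\mathfrak L_2$. Conversely, for all Hilbert spaces $\mathfrak L_1,\mathfrak L_2$ and every $s\in\mathcal S(\mathfrak L_1,\mathfrak L_2)$ there are a Hilbert space $\mathfrak H$, a simple closed isometric operator $V$ in $\mathfrak H$ and a unitary boundary pair $(\mathfrak L_1\times\mathfrak L_2,\Gamma)$ for $V$ whose Weyl function coincides with $s$ on $\mathbb D$. Likewise, if $s$ is only given as a holomorphic $\mathbf B(\mathfrak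 L_1,\mathfrak L_2)$-valued function on a nonempty open set $\Omega\subseteq\mathbb D$ and its kernel $\mathsf K^s$ is nonnegative on $\Omega$ (in the same sense), there are such $\mathfrak H$, $V$, $\Gamma$ for which the Weyl function coincides with $s$ on $\Omega$. -/

import Mathlib

open scoped ComplexConjugate ComplexOrder

noncomputable section

/-- A linear relation from `E` to `F`: a linear subspace of `E × F`. -/
abbrev LinRel (E F : Type*) [AddCommGroup E] [Module ℂ E] [AddCommGroup F] [Module ℂ F] :=
  Submodule ℂ (E × F)

namespace LinRel

section Basic

variable {E F : Type*} [AddCommGroup E] [Module ℂ E] [AddCommGroup F] [Module ℂ F]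

/-- The kernel `{f | {f, 0} ∈ T}` of a linear relation. -/
def ker (T : LinRel E F) : Submodule ℂ E := T.comap (LinearMap.inl ℂ E F)

/-- The range of a linear relation. -/
def ran (T : LinRel E F) : Submodule ℂ F := T.map (LinearMap.snd ℂ E F)

/-- The inverse `{{f', f} | {f, f'} ∈ T}` of a linear relation. -/
def inv (T : LinRel E F) : LinRel F E :=
  T.comap (LinearMap.prod (LinearMap.snd ℂ F E) (LinearMap.fst ℂ F E))

/-- `T - z I`, i.e. `{{f, f' - z f} | {f, f'} ∈ T}`. -/
def subScalar (T : LinRel E E) (z : ℂ) : LinRel E E :=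
  T.map (LinearMap.prod (LinearMap.fst ℂ E E) (LinearMap.snd ℂ E E - z • LinearMap.fst ℂ E E))

/-- `I - z T`, i.e. `{{f, f - z f'} | {f, f'} ∈ T}`. -/
def oneSubSmul (T : LinRel E E) (z : ℂ) : LinRel E E :=
  T.map (LinearMap.prod (LinearMap.fst ℂ E E) (LinearMap.fst ℂ E E - z • LinearMap.snd ℂ E E))

/-- The point spectrum: `T` contains `{f, z f}` for some `f ≠ 0`. -/
def pointSpectrum (T : LinRel E E) : Set ℂ := {z | ∃ f : E, f ≠ 0 ∧ (f, z • f) ∈ T}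

theorem mem_ker {T : LinRel E F} {f : E} : f ∈ T.ker ↔ (f, (0 : F)) ∈ T := by
  simp [ker]

theorem mem_inv {T : LinRel E F} {f : E} {g : F} : (g, f) ∈ T.inv ↔ (f, g) ∈ T := by
  simp [inv]

theorem mem_subScalar {T : LinRel E E} {z : ℂ} {f g : E} :
    (f, g) ∈ T.subScalar z ↔ ∃ f' : E, (f, f') ∈ T ∧ f' - z • f = g := by
  constructor
  · rintro ⟨⟨a, b⟩, h, e⟩
    obtain ⟨rfl, rfl⟩ := Prod.mk.inj e
    exact ⟨b, h, rfl⟩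
  · rintro ⟨b, h, rfl⟩
    exact ⟨(f, b), h, rfl⟩

theorem mem_oneSubSmul {T : LinRel E E} {z : ℂ} {f g : E} :
    (f, g) ∈ T.oneSubSmul z ↔ ∃ f' : E, (f, f') ∈ T ∧ f - z • f' = g := by
  constructor
  · rintro ⟨⟨a, b⟩, h, e⟩
    obtain ⟨rfl, rfl⟩ := Prod.mk.inj e
    exact ⟨b, h, rfl⟩
  · rintro ⟨b, h, rfl⟩
    exact ⟨(f, b), h, rfl⟩

end Basic

section Normed

variable {E F : Type*} [NormedAddCommGroup E] [InnerProductSpace ℂ E]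
  [NormedAddCommGroup F] [InnerProductSpace ℂ F]

/-- The relation `T` is the graph of the bounded everywhere defined operator `A`. -/
def IsGraphOf (T : LinRel E F) (A : E →L[ℂ] F) : Prop :=
  T = LinearMap.graph (A : E →ₗ[ℂ] F)

/-- `z` lies in the resolvent set of `T`, and `R` is the bounded everywhere defined operator
`(T - z I)⁻¹`. -/
def IsResolventAt (T : LinRel E E) (z : ℂ) (R : E →L[ℂ] E) : Prop :=
  (T.subScalar z).inv.IsGraphOf R

/-- `V` is (the graph of) a closed, single-valued, isometric operator; its domain may be any
linear subspace. -/
structure IsClosedIsometricOperator (V : LinRel E E) : Prop where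
  closed : IsClosed (V : Set (E × E))
  singleValued : ∀ f' : E, ((0 : E), f') ∈ V → f' = 0
  isometric : ∀ f f' : E, (f, f') ∈ V → ‖f'‖ = ‖f‖

/-- The defect subspace: the orthogonal complement of `ran (I - conj z • V)`. -/
def defect (V : LinRel E E) (z : ℂ) : Submodule ℂ E := ((V.oneSubSmul (conj z)).ran)ᗮ

/-- An isometric operator is simple if it has no eigenvalue off the unit circle and its defect
subspaces at the points off the unit circle span a dense subspace. -/
structure IsSimple (V : LinRel E E) : Prop where
  pointSpectrum_subset : ∀ z ∈ V.pointSpectrum, ‖z‖ = 1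
  span_defect : (⨆ z ∈ {z : ℂ | ‖z‖ ≠ 1}, V.defect z).topologicalClosure = ⊤

end Normed

end LinRel

section BoundaryPair

variable {H L₁ L₂ : Type*}
  [NormedAddCommGroup H] [InnerProductSpace ℂ H]
  [NormedAddCommGroup L₁] [InnerProductSpace ℂ L₁]
  [NormedAddCommGroup L₂] [InnerProductSpace ℂ L₂]

/-- The identity `(f, g) - (f', g') = (u₁, v₁) - (u₂, v₂)` for the elements
`p = {(f, f'), (u₁, u₂)}` and `q = {(g, g'), (v₁, v₂)}` of `H² × (L₁ × L₂)`
(Mathlib's inner product is linear in the second argument). -/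
def GreenIdentity (p q : (H × H) × (L₁ × L₂)) : Prop :=
  inner ℂ q.1.1 p.1.1 - inner ℂ q.1.2 p.1.2 = inner ℂ q.2.1 p.2.1 - inner ℂ q.2.2 p.2.2

/-- `(L₁ × L₂, Γ)` is a unitary boundary pair for the closed isometric operator `V`. -/
structure IsUnitaryBoundaryPair (V : LinRel H H) (Γ : LinRel (H × H) (L₁ × L₂)) : Prop where
  isometricOperator : V.IsClosedIsometricOperator
  ker_eq : V = Γ.ker
  green : ∀ p ∈ Γ, ∀ q ∈ Γ, GreenIdentity p q
  maximal : ∀ q : (H × H) × (L₁ × L₂), (∀ p ∈ Γ, GreenIdentity p q) → q ∈ Γ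

namespace BoundaryPair

/-- The component `Γ₁ = {{(f, f'), u₁} | {(f, f'), (u₁, u₂)} ∈ Γ for some u₂}`. -/
def comp₁ (Γ : LinRel (H × H) (L₁ × L₂)) : LinRel (H × H) L₁ :=
  Γ.map (LinearMap.prodMap LinearMap.id (LinearMap.fst ℂ L₁ L₂))

/-- The component `Γ₂ = {{(f, f'), u₂} | {(f, f'), (u₁, u₂)} ∈ Γ for some u₁}`. -/
def comp₂ (Γ : LinRel (H × H) (L₁ × L₂)) : LinRel (H × H) L₂ :=
  Γ.map (LinearMap.prodMap LinearMap.id (LinearMap.snd ℂ L₁ L₂))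

/-- The extension `V₁ = ker Γ₁`. -/
def ext₁ (Γ : LinRel (H × H) (L₁ × L₂)) : LinRel H H := (comp₁ Γ).ker

/-- The extension `V₂ = ker Γ₂`. -/
def ext₂ (Γ : LinRel (H × H) (L₁ × L₂)) : LinRel H H := (comp₂ Γ).ker

/-- The linear map `(u, f) ↦ ((f, z f), u)`. -/
def eigenEmbedding (H L : Type*) [AddCommGroup H] [Module ℂ H] [AddCommGroup L] [Module ℂ L]
    (z : ℂ) : (L × H) →ₗ[ℂ] ((H × H) × L) :=
  LinearMap.prod
    (LinearMap.prod (LinearMap.snd ℂ L H) (z • LinearMap.snd ℂ L H))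
    (LinearMap.fst ℂ L H)

/-- The `γ`-field `γ₁(z)` as a relation from `L₁` to `H`: the pairs `{u₁, f}` with
`{(f, z f), u₁} ∈ Γ₁`. -/
def gammaField₁ (Γ : LinRel (H × H) (L₁ × L₂)) (z : ℂ) : LinRel L₁ H :=
  (comp₁ Γ).comap (eigenEmbedding H L₁ z)

/-- The `γ`-field `γ₂(z)` as a relation from `L₂` to `H`: the pairs `{u₂, f}` with
`{(f, z f), u₂} ∈ Γ₂`. -/
def gammaField₂ (Γ : LinRel (H × H) (L₁ × L₂)) (z : ℂ) : LinRel L₂ H :=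
  (comp₂ Γ).comap (eigenEmbedding H L₂ z)

/-- The Weyl family at `z`: the pairs `{u₁, u₂}` with `{(f, z f), (u₁, u₂)} ∈ Γ` for some `f`. -/
def weylFamily (Γ : LinRel (H × H) (L₁ × L₂)) (z : ℂ) : LinRel L₁ L₂ :=
  (Γ.comap (eigenEmbedding H (L₁ × L₂) z)).map (LinearMap.fst ℂ (L₁ × L₂) H)

theorem mem_ext₁ {Γ : LinRel (H × H) (L₁ × L₂)} {f f' : H} :
    (f, f') ∈ ext₁ Γ ↔ ∃ u₂ : L₂, ((f, f'), ((0 : L₁), u₂)) ∈ Γ := by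
  rw [ext₁, LinRel.mem_ker]
  simp [comp₁]

theorem mem_ext₂ {Γ : LinRel (H × H) (L₁ × L₂)} {f f' : H} :
    (f, f') ∈ ext₂ Γ ↔ ∃ u₁ : L₁, ((f, f'), (u₁, (0 : L₂))) ∈ Γ := by
  rw [ext₂, LinRel.mem_ker]
  simp [comp₂]

theorem mem_gammaField₁ {Γ : LinRel (H × H) (L₁ × L₂)} {z : ℂ} {u₁ : L₁} {f : H} :
    (u₁, f) ∈ gammaField₁ Γ z ↔ ∃ u₂ : L₂, ((f, z • f), (u₁, u₂)) ∈ Γ := by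
  simp [gammaField₁, eigenEmbedding, comp₁]

theorem mem_gammaField₂ {Γ : LinRel (H × H) (L₁ × L₂)} {z : ℂ} {u₂ : L₂} {f : H} :
    (u₂, f) ∈ gammaField₂ Γ z ↔ ∃ u₁ : L₁, ((f, z • f), (u₁, u₂)) ∈ Γ := by
  simp [gammaField₂, eigenEmbedding, comp₂]

theorem mem_weylFamily {Γ : LinRel (H × H) (L₁ × L₂)} {z : ℂ} {u₁ : L₁} {u₂ : L₂} :
    (u₁, u₂) ∈ weylFamily Γ z ↔ ∃ f : H, ((f, z • f), (u₁, u₂)) ∈ Γ := by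
  simp [weylFamily, eigenEmbedding]

end BoundaryPair

end BoundaryPair

/-- The open unit disk. -/
def unitDisk : Set ℂ := {z | ‖z‖ < 1}

/-- The exterior of the closed unit disk (without the point at infinity). -/
def exteriorDisk : Set ℂ := {z | 1 < ‖z‖}

section Schur

variable {L₁ L₂ : Type*}
  [NormedAddCommGroup L₁] [InnerProductSpace ℂ L₁] [CompleteSpace L₁]
  [NormedAddCommGroup L₂] [InnerProductSpace ℂ L₂] [CompleteSpace L₂]

/-- The Schur class: holomorphic contraction-valued operator functions on the unit disk. -/
structure IsSchur (s : ℂ → L₁ →L[ℂ] L₂) : Prop where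
  holomorphic : DifferentiableOn ℂ s unitDisk
  contractive : ∀ z ∈ unitDisk, ‖s z‖ ≤ 1

/-- The kernel `(I - s(z) s(w)^*) / (1 - z conj w)`. -/
def schurKernel (s : ℂ → L₁ →L[ℂ] L₂) (z w : ℂ) : L₂ →L[ℂ] L₂ :=
  (1 - z * conj w)⁻¹ •
    (ContinuousLinearMap.id ℂ L₂ - (s z).comp (ContinuousLinearMap.adjoint (s w)))

/-- `s` is holomorphic on `Ω` and its kernel has no negative squares there: all the Hermitian
matrices `((K(ω i, ω j) f j, f i))` are positive semidefinite. -/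
structure IsSchurKernelOn (Ω : Set ℂ) (s : ℂ → L₁ →L[ℂ] L₂) : Prop where
  holomorphic : DifferentiableOn ℂ s Ω
  posSemidef : ∀ (n : ℕ) (ω : Fin n → ℂ) (f : Fin n → L₂), (∀ i, ω i ∈ Ω) →
    (Matrix.of fun i j : Fin n =>
      (inner ℂ (f i) (schurKernel s (ω i) (ω j) (f j)) : ℂ)).PosSemidef

end Schur

end

universe u v w

/-! With `g = f` and `g' = f'`, the Green identity says that `{f', u₁} ↦ {f, u₂}` preserves the
norm, so it is an isometric relation from `H ⊕ L₁` to `H ⊕ L₂`. Maximality makes it total in both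
directions, that is, unitary (`IsUnitaryBoundaryPair.exists_left`, and the same for `flip`). Writing
it as a block operator `[[T, F], [G, D]]` (`IsUnitaryBoundaryPair.exists_blocks`) turns the direct
part into algebra: `T` is the inverse of `V₁`, the first γ-field is `(1 - zT)⁻¹ F`, and the Weyl
function is the transfer function `D + z G (1 - zT)⁻¹ F`. The statements about `V₂` and the second
γ-field come from the blocks of the flipped relation. Contractivity of the Weyl function is
conservation of norm at `f' = z f`.

The kernel of a Schur function is nonnegative because the adjoint of multiplication by `s` on the
Hardy space is a contraction acting explicitly on Szegő kernels. The proof uses only circle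
averages, for functions continuous up to the boundary, and then a dilation.

For the converse, let `k` be the kernel functions of the reproducing kernel space of `s`. The
elements `{(conj z • k_z v, k_z v), (s(z)* v, v)}` satisfy the Green identity precisely because of
the formula for the kernel, so their closed span is conservative. It need not be total.
`unitaryExtension` repairs this by letting shifts absorb the source defect and supply the target
defect. Compressing to the closed span of the eigenvectors gives simplicity without changing the
Weyl function, and one Green identity against the elements above identifies that function with `s`
(`weylFamily_isGraphOf_of_mem`). -/

noncomputable section

/-! ### Closed relations bounded by one. -/

section IsometricRelation

variable {X Y : Type*} [NormedAddCommGroup X] [InnerProductSpace ℂ X]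
  [NormedAddCommGroup Y] [InnerProductSpace ℂ Y]

/-- The domain of a closed relation bounded by one is closed. -/
theorem LinRel.isClosed_map_fst [CompleteSpace X] [CompleteSpace Y] {G : LinRel X Y}
    (hG : IsClosed (G : Set (X × Y))) (hb : ∀ x y, (x, y) ∈ G → ‖y‖ ≤ ‖x‖) :
    IsClosed (G.map (LinearMap.fst ℂ X Y) : Set X) := by
  have : CompleteSpace G := hG.completeSpace_coe
  let φ : G →L[ℂ] X := (ContinuousLinearMap.fst ℂ X Y).comp G.subtypeL
  -- In the maximum norm of the product, the bound gives `‖(x, y)‖ = ‖x‖`, so the projection to the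
  -- domain is bounded below on the graph.
  have hφ : AntilipschitzWith 1 φ := by
    refine AddMonoidHomClass.antilipschitz_of_bound φ fun p => ?_
    obtain ⟨⟨x, y⟩, hp⟩ := p
    simpa [φ] using hb x y hp
  have h := hφ.isClosed_range φ.uniformContinuous
  convert h using 1
  ext x
  simp [φ]

theorem LinRel.isClosed_inv {G : LinRel X Y} (hG : IsClosed (G : Set (X × Y))) :
    IsClosed (G.inv : Set (Y × X)) :=
  hG.preimage (continuous_snd.prodMk continuous_fst)

/-- A total relation bounded by one is the graph of a contraction. -/
theorem LinRel.exists_contraction_of_total {G : LinRel X Y}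
    (hb : ∀ x y, (x, y) ∈ G → ‖y‖ ≤ ‖x‖) (ht : ∀ x, ∃ y, (x, y) ∈ G) :
    ∃ A : X →L[ℂ] Y, ‖A‖ ≤ 1 ∧ ∀ x y, (x, y) ∈ G ↔ y = A x := by
  choose a ha using ht
  have huniq : ∀ x y, (x, y) ∈ G → y = a x := fun x y h => by
    have h0 := hb 0 (y - a x) (by simpa using G.sub_mem h (ha x))
    simpa [sub_eq_zero] using h0
  let A : X →ₗ[ℂ] Y :=
    { toFun := a
      map_add' := fun x y => (huniq _ _ (by simpa using G.add_mem (ha x) (ha y))).symm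
      map_smul' := fun c x => (huniq _ _ (by simpa using G.smul_mem c (ha x))).symm }
  refine ⟨A.mkContinuous 1 fun x => by simpa [A] using hb _ _ (ha x),
    A.mkContinuous_norm_le zero_le_one _, fun x y => ⟨huniq x y, ?_⟩⟩
  rintro rfl
  exact ha x

end IsometricRelation

/-! ### Green identity, maximality and the unitary block operator. -/

namespace BoundaryPair

variable {H L₁ L₂ : Type*}
  [NormedAddCommGroup H] [InnerProductSpace ℂ H]
  [NormedAddCommGroup L₁] [InnerProductSpace ℂ L₁]
  [NormedAddCommGroup L₂] [InnerProductSpace ℂ L₂]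

/-- The conservation law `‖f‖² + ‖u₂‖² = ‖f'‖² + ‖u₁‖²` on a relation in `H² × (L₁ × L₂)`. -/
def IsConservative (Γ : LinRel (H × H) (L₁ × L₂)) : Prop :=
  ∀ f f' u₁ u₂, ((f, f'), (u₁, u₂)) ∈ Γ → ‖f‖ ^ 2 + ‖u₂‖ ^ 2 = ‖f'‖ ^ 2 + ‖u₁‖ ^ 2

/-- Polarization: the conservation law is the diagonal of the sesquilinear identity, applied here to
`q ± p` and `q ± i p`. -/
theorem IsConservative.green {Γ : LinRel (H × H) (L₁ × L₂)} (h : IsConservative Γ) :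
    ∀ p ∈ Γ, ∀ q ∈ Γ, GreenIdentity p q := by
  rintro ⟨⟨f, f'⟩, u₁, u₂⟩ hp ⟨⟨g, g'⟩, v₁, v₂⟩ hq
  have h1 := h _ _ _ _ (Γ.add_mem hq hp)
  have h2 := h _ _ _ _ (Γ.sub_mem hq hp)
  have h3 := h _ _ _ _ (Γ.add_mem hq (Γ.smul_mem Complex.I hp))
  have h4 := h _ _ _ _ (Γ.sub_mem hq (Γ.smul_mem Complex.I hp))
  simp only [GreenIdentity, inner_eq_sum_norm_sq_div_four, RCLike.I_to_complex, sub_eq_iff_eq_add]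
  have h1' := congrArg (fun r : ℝ => (r : ℂ)) h1
  have h2' := congrArg (fun r : ℝ => (r : ℂ)) h2
  have h3' := congrArg (fun r : ℝ => (r : ℂ)) h3
  have h4' := congrArg (fun r : ℝ => (r : ℂ)) h4
  push_cast at h1' h2' h3' h4'
  simp only [Complex.coe_algebraMap]
  linear_combination (h1' - h2' + (h4' - h3') * Complex.I) / 4

theorem isConservative_of_green {Γ : LinRel (H × H) (L₁ × L₂)}
    (green : ∀ p ∈ Γ, ∀ q ∈ Γ, GreenIdentity p q) : IsConservative Γ := by
  intro f f' u₁ u₂ hp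
  have := green _ hp _ hp
  simp only [GreenIdentity, inner_self_eq_norm_sq_to_K] at this
  have h2 : ((‖f‖ ^ 2 - ‖f'‖ ^ 2 : ℝ) : ℂ) = ((‖u₁‖ ^ 2 - ‖u₂‖ ^ 2 : ℝ) : ℂ) := by
    push_cast; exact this
  have h3 := Complex.ofReal_injective h2
  linarith

theorem _root_.IsUnitaryBoundaryPair.isConservative {V : LinRel H H}
    {Γ : LinRel (H × H) (L₁ × L₂)} (h : IsUnitaryBoundaryPair V Γ) : IsConservative Γ :=
  isConservative_of_green h.green

theorem isClosed_setOf_greenIdentity (p : (H × H) × (L₁ × L₂)) :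
    IsClosed {q | GreenIdentity p q} := by
  unfold GreenIdentity
  exact isClosed_eq (by fun_prop) (by fun_prop)

theorem isClosed_of_maximal {Γ : LinRel (H × H) (L₁ × L₂)}
    (green : ∀ p ∈ Γ, ∀ q ∈ Γ, GreenIdentity p q)
    (maximal : ∀ q : (H × H) × (L₁ × L₂), (∀ p ∈ Γ, GreenIdentity p q) → q ∈ Γ) :
    IsClosed (Γ : Set ((H × H) × (L₁ × L₂))) := by
  have : (Γ : Set ((H × H) × (L₁ × L₂))) = ⋂ p ∈ Γ, {q | GreenIdentity p q} := by
    ext q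
    simp only [SetLike.mem_coe, Set.mem_iInter, Set.mem_ofPred_eq]
    exact ⟨fun hq p hp => green p hp q hq, maximal q⟩
  rw [this]
  exact isClosed_biInter fun p _ => isClosed_setOf_greenIdentity p

theorem isUnitaryBoundaryPair_of_maximal {Γ : LinRel (H × H) (L₁ × L₂)}
    (green : ∀ p ∈ Γ, ∀ q ∈ Γ, GreenIdentity p q)
    (maximal : ∀ q : (H × H) × (L₁ × L₂), (∀ p ∈ Γ, GreenIdentity p q) → q ∈ Γ) :
    IsUnitaryBoundaryPair Γ.ker Γ := by
  have h := isConservative_of_green green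
  refine ⟨⟨?_, ?_, ?_⟩, rfl, green, maximal⟩
  · exact (isClosed_of_maximal green maximal).preimage (by simp only [LinearMap.coe_inl]; fun_prop)
  · intro f' hf'
    have := h _ _ _ _ (LinRel.mem_ker.1 hf')
    simpa using this.symm
  · intro f f' hf
    have := h _ _ _ _ (LinRel.mem_ker.1 hf)
    have h2 : ‖f'‖ ^ 2 = ‖f‖ ^ 2 := by simpa using this.symm
    exact (sq_eq_sq₀ (norm_nonneg _) (norm_nonneg _)).1 h2

/-- A conservative relation that is total in both directions is a unitary boundary pair. -/
theorem IsConservative.isUnitaryBoundaryPair {Γ : LinRel (H × H) (L₁ × L₂)}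
    (h : IsConservative Γ)
    (h₁ : ∀ (f' : H) (u₁ : L₁), ∃ (f : H) (u₂ : L₂), ((f, f'), (u₁, u₂)) ∈ Γ)
    (h₂ : ∀ (f : H) (u₂ : L₂), ∃ (f' : H) (u₁ : L₁), ((f, f'), (u₁, u₂)) ∈ Γ) :
    IsUnitaryBoundaryPair Γ.ker Γ := by
  have green := h.green
  have maximal : ∀ q : (H × H) × (L₁ × L₂), (∀ p ∈ Γ, GreenIdentity p q) → q ∈ Γ := by
    rintro ⟨⟨g, g'⟩, v₁, v₂⟩ hq
    -- An element of `Γ` is chosen to agree with `q` in the components `g'`, `v₁`. The difference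
    -- has only the components `g - k` and `v₂ - w₂`, and testing it against an element of `Γ` with
    -- these same components yields the sum of their squared norms.
    obtain ⟨k, w₂, hk⟩ := h₁ g' v₁
    obtain ⟨f', u₁, hp⟩ := h₂ (g - k) (v₂ - w₂)
    have e1 := hq _ hp
    have e2 := green _ hp _ hk
    simp only [GreenIdentity] at e1 e2
    have e3 : inner ℂ (g - k) (g - k) + inner ℂ (v₂ - w₂) (v₂ - w₂) = (0 : ℂ) := by
      rw [inner_sub_left, inner_sub_left v₂]
      linear_combination e1 - e2
    simp only [inner_self_eq_norm_sq_to_K] at e3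
    have e4 : ‖g - k‖ ^ 2 + ‖v₂ - w₂‖ ^ 2 = 0 := by
      apply Complex.ofReal_injective
      push_cast
      exact e3
    have e5 : ‖g - k‖ = 0 := by nlinarith [sq_nonneg ‖g - k‖, sq_nonneg ‖v₂ - w₂‖]
    have e6 : ‖v₂ - w₂‖ = 0 := by nlinarith [sq_nonneg ‖g - k‖, sq_nonneg ‖v₂ - w₂‖]
    rw [norm_eq_zero, sub_eq_zero] at e5 e6
    rwa [e5, e6]
  exact isUnitaryBoundaryPair_of_maximal green maximal

/-- The relation `{f', u₁} ↦ {f, u₂}` between Hilbert space sums. -/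
def transfer (Γ : LinRel (H × H) (L₁ × L₂)) :
    LinRel (WithLp 2 (H × L₁)) (WithLp 2 (H × L₂)) :=
  Γ.comap
    ({ toFun := fun p => ((p.2.fst, p.1.fst), (p.1.snd, p.2.snd))
       map_add' := fun _ _ => rfl
       map_smul' := fun _ _ => rfl } :
      (WithLp 2 (H × L₁) × WithLp 2 (H × L₂)) →ₗ[ℂ] ((H × H) × (L₁ × L₂)))

theorem mem_transfer {Γ : LinRel (H × H) (L₁ × L₂)} {a : WithLp 2 (H × L₁)}
    {b : WithLp 2 (H × L₂)} : (a, b) ∈ transfer Γ ↔ ((b.fst, a.fst), (a.snd, b.snd)) ∈ Γ :=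
  Iff.rfl

theorem IsConservative.norm_eq {Γ : LinRel (H × H) (L₁ × L₂)} (h : IsConservative Γ)
    {a : WithLp 2 (H × L₁)} {b : WithLp 2 (H × L₂)} (hab : (a, b) ∈ transfer Γ) :
    ‖b‖ = ‖a‖ := by
  have := h _ _ _ _ (mem_transfer.1 hab)
  rw [← WithLp.prod_norm_sq_eq_of_L2, ← WithLp.prod_norm_sq_eq_of_L2] at this
  exact (sq_eq_sq₀ (norm_nonneg _) (norm_nonneg _)).1 this

theorem isClosed_transfer {Γ : LinRel (H × H) (L₁ × L₂)}
    (hΓ : IsClosed (Γ : Set ((H × H) × (L₁ × L₂)))) :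
    IsClosed (transfer Γ : Set (WithLp 2 (H × L₁) × WithLp 2 (H × L₂))) := by
  have hc : Continuous fun p : WithLp 2 (H × L₁) × WithLp 2 (H × L₂) =>
      ((p.2.fst, p.1.fst), (p.1.snd, p.2.snd)) := by fun_prop
  exact hΓ.preimage hc

/-- The relation with the roles of the two coordinates interchanged. -/
def flip (Γ : LinRel (H × H) (L₁ × L₂)) : LinRel (H × H) (L₂ × L₁) :=
  Γ.comap
    ({ toFun := fun p => ((p.1.2, p.1.1), (p.2.2, p.2.1))
       map_add' := fun _ _ => rfl
       map_smul' := fun _ _ => rfl } :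
      ((H × H) × (L₂ × L₁)) →ₗ[ℂ] ((H × H) × (L₁ × L₂)))

theorem mem_flip {Γ : LinRel (H × H) (L₁ × L₂)} {f f' : H} {u₁ : L₁} {u₂ : L₂} :
    ((f', f), (u₂, u₁)) ∈ flip Γ ↔ ((f, f'), (u₁, u₂)) ∈ Γ := Iff.rfl

/-- Interchanging both coordinates only changes the sign of the Green identity. This transfers every
result about `V₁` and the source side to `V₂` and the target side. -/
theorem _root_.IsUnitaryBoundaryPair.flip {V : LinRel H H}
    {Γ : LinRel (H × H) (L₁ × L₂)} (h : IsUnitaryBoundaryPair V Γ) :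
    IsUnitaryBoundaryPair (flip Γ).ker (flip Γ) := by
  have swap : ∀ (f f' : H) (u₁ : L₁) (u₂ : L₂) (g g' : H) (v₁ : L₁) (v₂ : L₂),
      GreenIdentity ((f', f), (u₂, u₁)) ((g', g), (v₂, v₁)) ↔
        GreenIdentity ((f, f'), (u₁, u₂)) ((g, g'), (v₁, v₂)) := by
    intro f f' u₁ u₂ g g' v₁ v₂
    simp only [GreenIdentity]
    constructor <;> intro e <;> linear_combination -e
  refine isUnitaryBoundaryPair_of_maximal ?_ ?_
  · rintro ⟨⟨f', f⟩, u₂, u₁⟩ hp ⟨⟨g', g⟩, v₂, v₁⟩ hq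
    exact (swap _ _ _ _ _ _ _ _).2 (h.green _ hp _ hq)
  · rintro ⟨⟨g', g⟩, v₂, v₁⟩ hq
    refine h.maximal ((g, g'), (v₁, v₂)) ?_
    rintro ⟨⟨f, f'⟩, u₁, u₂⟩ hp
    exact (swap _ _ _ _ _ _ _ _).1 (hq ((f', f), (u₂, u₁)) hp)

variable [CompleteSpace H] [CompleteSpace L₁] [CompleteSpace L₂]

/-- The domain of the transfer relation is closed, since the relation is closed and isometric. A
vector `x` orthogonal to it gives an element with `f = 0`, `u₂ = 0` that satisfies the Green
identity against all of `Γ`. By maximality it lies in `Γ`, and conservation forces `x = 0`. -/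
theorem _root_.IsUnitaryBoundaryPair.exists_left {V : LinRel H H}
    {Γ : LinRel (H × H) (L₁ × L₂)} (h : IsUnitaryBoundaryPair V Γ) (f' : H) (u₁ : L₁) :
    ∃ (f : H) (u₂ : L₂), ((f, f'), (u₁, u₂)) ∈ Γ := by
  have hc := LinRel.isClosed_map_fst
    (isClosed_transfer (isClosed_of_maximal h.green h.maximal))
    fun x y hxy => (h.isConservative.norm_eq hxy).le
  set M := (transfer Γ).map (LinearMap.fst ℂ _ _) with hM
  have : CompleteSpace M := hc.completeSpace_coe
  have hbot : Mᗮ = ⊥ := by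
    rw [Submodule.eq_bot_iff]
    intro x hx
    have hmem : (((0 : H), x.fst), (x.snd, (0 : L₂))) ∈ Γ := by
      refine h.maximal _ ?_
      rintro ⟨⟨f, f'⟩, u₁, u₂⟩ hp
      have hxM := Submodule.inner_left_of_mem_orthogonal (K := M)
        (u := WithLp.toLp 2 (f', u₁)) ⟨(WithLp.toLp 2 (f', u₁), WithLp.toLp 2 (f, u₂)), hp, rfl⟩ hx
      simp only [WithLp.prod_inner_apply, WithLp.ofLp_fst, WithLp.ofLp_snd] at hxM
      simp only [GreenIdentity, inner_zero_left]
      linear_combination -hxM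
    have := h.isConservative _ _ _ _ hmem
    simp only [norm_zero] at this
    rw [← norm_eq_zero, ← sq_eq_zero_iff, WithLp.prod_norm_sq_eq_of_L2]
    linarith
  have htop : M = ⊤ := Submodule.orthogonal_eq_bot_iff.1 hbot
  obtain ⟨⟨a, b⟩, hab, e⟩ : WithLp.toLp 2 (f', u₁) ∈ M := htop ▸ Submodule.mem_top
  obtain rfl : a = _ := e
  exact ⟨_, _, hab⟩

theorem _root_.IsUnitaryBoundaryPair.exists_blocks {V : LinRel H H}
    {Γ : LinRel (H × H) (L₁ × L₂)} (h : IsUnitaryBoundaryPair V Γ) :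
    ∃ (T : H →L[ℂ] H) (F : L₁ →L[ℂ] H) (G : H →L[ℂ] L₂) (D : L₁ →L[ℂ] L₂), ‖T‖ ≤ 1 ∧
      ∀ f f' u₁ u₂, ((f, f'), (u₁, u₂)) ∈ Γ ↔ f = T f' + F u₁ ∧ u₂ = G f' + D u₁ := by
  obtain ⟨U, hU, hmem⟩ := LinRel.exists_contraction_of_total (G := transfer Γ)
    (fun x y hxy => (h.isConservative.norm_eq hxy).le) (fun a => by
      obtain ⟨f, u₂, hf⟩ := h.exists_left a.fst a.snd
      exact ⟨WithLp.toLp 2 (f, u₂), hf⟩)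
  let i := (WithLp.prodContinuousLinearEquiv 2 ℂ H L₁).symm.toContinuousLinearMap
  let j := (WithLp.prodContinuousLinearEquiv 2 ℂ H L₂).toContinuousLinearMap
  let W := j ∘L U ∘L i
  refine ⟨.fst ℂ _ _ ∘L W ∘L .inl ℂ _ _, .fst ℂ _ _ ∘L W ∘L .inr ℂ _ _,
    .snd ℂ _ _ ∘L W ∘L .inl ℂ _ _, .snd ℂ _ _ ∘L W ∘L .inr ℂ _ _, ?_, ?_⟩
  · refine ContinuousLinearMap.opNorm_le_bound _ zero_le_one fun x => ?_
    have h1 := (U.le_of_opNorm_le hU (WithLp.toLp 2 (x, 0)))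
    have h2 : ‖(U (WithLp.toLp 2 (x, 0))).fst‖ ≤ ‖U (WithLp.toLp 2 (x, 0))‖ := by
      refine (sq_le_sq₀ (norm_nonneg _) (norm_nonneg _)).1 ?_
      rw [WithLp.prod_norm_sq_eq_of_L2]
      nlinarith [sq_nonneg ‖(U (WithLp.toLp 2 (x, 0))).snd‖]
    have h3 : ‖WithLp.toLp 2 (x, (0 : L₁))‖ = ‖x‖ := by simp
    rw [h3] at h1
    exact h2.trans h1
  · intro f f' u₁ u₂
    have e1 : WithLp.toLp 2 (f', u₁) = WithLp.toLp 2 (f', 0) + WithLp.toLp 2 (0, u₁) := by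
      rw [← WithLp.toLp_add]; simp
    have := hmem (WithLp.toLp 2 (f', u₁)) (WithLp.toLp 2 (f, u₂))
    rw [mem_transfer] at this
    refine this.trans ?_
    rw [e1, map_add, WithLp.ext_iff, Prod.ext_iff]
    rfl

end BoundaryPair

/-! ### Resolvents, γ-fields and the Weyl function in terms of the blocks. -/

namespace BoundaryPair

section Resolvent

variable {H : Type*} [NormedAddCommGroup H] [InnerProductSpace ℂ H] [CompleteSpace H]

theorem isUnit_one_sub_smul {T : H →L[ℂ] H} (hT : ‖T‖ ≤ 1) {z : ℂ} (hz : ‖z‖ < 1) :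
    IsUnit (1 - z • T) := by
  refine isUnit_one_sub_of_norm_lt_one ?_
  rw [norm_smul]
  nlinarith [norm_nonneg z, norm_nonneg T]

theorem isUnit_smul_one_sub {T : H →L[ℂ] H} (hT : ‖T‖ ≤ 1) {z : ℂ} (hz : 1 < ‖z‖) :
    IsUnit (z • (1 : H →L[ℂ] H) - T) := by
  have h0 : z ≠ 0 := fun h => by simp [h] at hz; linarith
  have h := isUnit_one_sub_smul hT (z := z⁻¹) (by rw [norm_inv]; exact inv_lt_one_of_one_lt₀ hz)
  have e : z • (1 : H →L[ℂ] H) - T = (Units.mk0 z h0) • (1 - z⁻¹ • T) := by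
    simp [Units.smul_def, smul_sub, smul_smul, h0]
  rw [e]
  exact h.smul _

omit [CompleteSpace H] in
theorem apply_eq_iff_eq_inverse_apply {A : H →L[ℂ] H} (hA : IsUnit A) {f g : H} :
    A f = g ↔ f = Ring.inverse A g := by
  have h1 : ∀ x, A (Ring.inverse A x) = x := fun x => by
    rw [← mul_apply_eq_comp, Ring.mul_inverse_cancel _ hA]; rfl
  have h2 : ∀ x, Ring.inverse A (A x) = x := fun x => by
    rw [← mul_apply_eq_comp, Ring.inverse_mul_cancel _ hA]; rfl
  constructor
  · rintro rfl; rw [h2]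
  · rintro rfl; rw [h1]

omit [CompleteSpace H] in
theorem inverse_sub_inverse {A B : H →L[ℂ] H} (hA : IsUnit A) (hB : IsUnit B) :
    Ring.inverse A - Ring.inverse B = Ring.inverse A * (B - A) * Ring.inverse B := by
  rw [mul_sub, sub_mul, Ring.inverse_mul_cancel _ hA, mul_assoc, Ring.mul_inverse_cancel _ hB]
  simp

theorem differentiableOn_inverse_one_sub {T : H →L[ℂ] H} (hT : ‖T‖ ≤ 1) :
    DifferentiableOn ℂ (fun z : ℂ => Ring.inverse (1 - z • T)) unitDisk := by
  intro z hz
  obtain ⟨u, hu⟩ := isUnit_one_sub_smul hT hz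
  refine DifferentiableAt.differentiableWithinAt ?_
  refine DifferentiableAt.comp z (g := Ring.inverse) (f := fun z : ℂ => 1 - z • T) ?_ (by fun_prop)
  exact differentiableAt_inverse (hu ▸ u.isUnit)

theorem differentiableOn_inverse_smul_sub {T : H →L[ℂ] H} (hT : ‖T‖ ≤ 1) :
    DifferentiableOn ℂ (fun z : ℂ => Ring.inverse (z • (1 : H →L[ℂ] H) - T)) exteriorDisk := by
  intro z hz
  obtain ⟨u, hu⟩ := isUnit_smul_one_sub hT hz
  refine DifferentiableAt.differentiableWithinAt ?_
  refine DifferentiableAt.comp z (g := Ring.inverse)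
    (f := fun z : ℂ => z • (1 : H →L[ℂ] H) - T) ?_ (by fun_prop)
  exact differentiableAt_inverse (hu ▸ u.isUnit)

end Resolvent

theorem _root_.LinRel.isGraphOf_iff {E F : Type*} [NormedAddCommGroup E] [InnerProductSpace ℂ E]
    [NormedAddCommGroup F] [InnerProductSpace ℂ F] {T : LinRel E F} {A : E →L[ℂ] F} :
    T.IsGraphOf A ↔ ∀ x y, (x, y) ∈ T ↔ y = A x := by
  rw [LinRel.IsGraphOf, SetLike.ext_iff]
  simp [Prod.forall, LinearMap.mem_graph_iff]

variable {H L₁ L₂ : Type*}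
  [NormedAddCommGroup H] [InnerProductSpace ℂ H]
  [NormedAddCommGroup L₁] [InnerProductSpace ℂ L₁]
  [NormedAddCommGroup L₂] [InnerProductSpace ℂ L₂]

/-- The relation `Γ` is given by the block operator `[[T, F], [G, D]]` from `H × L₁` to
`H × L₂`. -/
def HasBlocks (Γ : LinRel (H × H) (L₁ × L₂)) (T : H →L[ℂ] H) (F : L₁ →L[ℂ] H) (G : H →L[ℂ] L₂)
    (D : L₁ →L[ℂ] L₂) : Prop :=
  ∀ f f' u₁ u₂, ((f, f'), (u₁, u₂)) ∈ Γ ↔ f = T f' + F u₁ ∧ u₂ = G f' + D u₁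

variable {Γ : LinRel (H × H) (L₁ × L₂)} {T : H →L[ℂ] H} {F : L₁ →L[ℂ] H} {G : H →L[ℂ] L₂}
  {D : L₁ →L[ℂ] L₂}

namespace HasBlocks

theorem isGraphOf_ext₁_inv (h : HasBlocks Γ T F G D) : (ext₁ Γ).inv.IsGraphOf T := by
  rw [LinRel.isGraphOf_iff]
  intro f' f
  simp [LinRel.mem_inv, mem_ext₁, h _ _ _ _]

/-- From `f = T f'` and `f' - z f = g` one gets `(1 - zT) f = T g`. Conversely `f' = g + z f` is
recovered. -/
theorem isResolventAt_ext₁ (h : HasBlocks Γ T F G D) {z : ℂ} (hu : IsUnit (1 - z • T)) :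
    (ext₁ Γ).IsResolventAt z (Ring.inverse (1 - z • T) * T) := by
  rw [LinRel.IsResolventAt, LinRel.isGraphOf_iff]
  intro g f
  rw [mul_apply_eq_comp, ← apply_eq_iff_eq_inverse_apply hu, LinRel.mem_inv,
    LinRel.mem_subScalar]
  simp only [mem_ext₁, h _ _ _ _, map_zero, add_zero, exists_and_left, exists_eq, and_true]
  constructor
  · rintro ⟨f', rfl, rfl⟩
    simp
  · intro e
    refine ⟨g + z • f, ?_, by simp⟩
    simp only [FunLike.coe_sub, Pi.sub_apply, one_apply_eq_self,
      FunLike.coe_smul, Pi.smul_apply] at e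
    rw [map_add, map_smul, ← e]; simp

/-- Setting `f' = z f` in the block equations and solving the first for `f` produces both the
γ-field and the transfer function. -/
theorem mem_eigen_iff (h : HasBlocks Γ T F G D) {z : ℂ} (hu : IsUnit (1 - z • T)) {f : H}
    {u₁ : L₁} {u₂ : L₂} : ((f, z • f), (u₁, u₂)) ∈ Γ ↔
      f = (Ring.inverse (1 - z • T) ∘L F) u₁ ∧
        u₂ = (D + z • G ∘L Ring.inverse (1 - z • T) ∘L F) u₁ := by
  rw [h]
  have e : f = T (z • f) + F u₁ ↔ f = (Ring.inverse (1 - z • T) ∘L F) u₁ := by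
    rw [ContinuousLinearMap.comp_apply, ← apply_eq_iff_eq_inverse_apply hu]
    simp [sub_eq_iff_eq_add, add_comm]
  rw [e]
  refine and_congr_right ?_
  rintro rfl
  simp [add_comm]

theorem isGraphOf_gammaField₁ (h : HasBlocks Γ T F G D) {z : ℂ} (hu : IsUnit (1 - z • T)) :
    (gammaField₁ Γ z).IsGraphOf (Ring.inverse (1 - z • T) ∘L F) := by
  rw [LinRel.isGraphOf_iff]
  intro u f
  simp only [mem_gammaField₁, h.mem_eigen_iff hu]
  simp

theorem isGraphOf_weylFamily (h : HasBlocks Γ T F G D) {z : ℂ} (hu : IsUnit (1 - z • T)) :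
    (weylFamily Γ z).IsGraphOf (D + z • G ∘L Ring.inverse (1 - z • T) ∘L F) := by
  rw [LinRel.isGraphOf_iff]
  intro u f
  simp only [mem_weylFamily, h.mem_eigen_iff hu]
  simp

end HasBlocks

variable {T' : H →L[ℂ] H} {F' : L₂ →L[ℂ] H} {G' : H →L[ℂ] L₁} {D' : L₂ →L[ℂ] L₁}

namespace HasBlocks

theorem isGraphOf_ext₂ (h : HasBlocks (flip Γ) T' F' G' D') : (ext₂ Γ).IsGraphOf T' := by
  rw [LinRel.isGraphOf_iff]
  intro f f'
  simp only [mem_ext₂, ← mem_flip, h _ _ _ _]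
  simp

theorem isResolventAt_ext₂ (h : HasBlocks (flip Γ) T' F' G' D') {z : ℂ}
    (hu : IsUnit (z • (1 : H →L[ℂ] H) - T')) :
    (ext₂ Γ).IsResolventAt z (-Ring.inverse (z • (1 : H →L[ℂ] H) - T')) := by
  rw [LinRel.IsResolventAt, LinRel.isGraphOf_iff]
  intro g f
  rw [FunLike.coe_neg, Pi.neg_apply, ← map_neg, ← apply_eq_iff_eq_inverse_apply hu,
    LinRel.mem_inv, LinRel.mem_subScalar]
  simp only [LinRel.isGraphOf_iff.1 h.isGraphOf_ext₂ _ _, exists_eq_left]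
  rw [eq_comm, ← neg_inj]
  simp [eq_comm]

theorem isGraphOf_gammaField₂ (h : HasBlocks (flip Γ) T' F' G' D') {z : ℂ}
    (hu : IsUnit (z • (1 : H →L[ℂ] H) - T')) :
    (gammaField₂ Γ z).IsGraphOf (Ring.inverse (z • (1 : H →L[ℂ] H) - T') ∘L F') := by
  rw [LinRel.isGraphOf_iff]
  intro u f
  rw [ContinuousLinearMap.comp_apply, ← apply_eq_iff_eq_inverse_apply hu]
  simp only [mem_gammaField₂, ← mem_flip, h _ _ _ _]
  simp [sub_eq_iff_eq_add, add_comm]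

end HasBlocks

theorem ext₂_eq_adjoint (green : ∀ p ∈ Γ, ∀ q ∈ Γ, GreenIdentity p q)
    (h : HasBlocks Γ T F G D) (h' : HasBlocks (flip Γ) T' F' G' D') :
    ext₂ Γ = (ext₁ Γ).inv.adjoint := by
  have hT : ∀ a x, inner ℂ (T a) x = inner ℂ a (T' x) := by
    intro a x
    -- One element has `u₂ = 0` and the other `u₁ = 0`, so the boundary terms vanish.
    have e := green ((x, T' x), (G' x, 0)) (mem_flip.1 ((h' _ _ _ _).2 (by simp)))
      ((T a, a), (0, G a)) ((h _ _ _ _).2 (by simp))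
    simpa [GreenIdentity, sub_eq_zero] using e
  ext ⟨x, y⟩
  rw [LinRel.isGraphOf_iff.1 h'.isGraphOf_ext₂, Submodule.mem_adjoint_iff]
  simp only [LinRel.isGraphOf_iff.1 h.isGraphOf_ext₁_inv _ _, sub_eq_zero]
  constructor
  · rintro rfl a b rfl
    exact hT _ _
  · intro e
    refine ext_inner_left ℂ fun a => ?_
    rw [← e a _ rfl, hT]

theorem norm_weyl_le (h : IsConservative Γ) {z : ℂ} (hz : ‖z‖ ≤ 1) {f : H} {u₁ : L₁} {u₂ : L₂}
    (hf : ((f, z • f), (u₁, u₂)) ∈ Γ) : ‖u₂‖ ≤ ‖u₁‖ := by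
  have e := h _ _ _ _ hf
  have h1 : ‖z • f‖ ^ 2 ≤ ‖f‖ ^ 2 := by
    rw [norm_smul, mul_pow]
    exact mul_le_of_le_one_left (sq_nonneg _) (pow_le_one₀ (norm_nonneg _) hz)
  exact (sq_le_sq₀ (norm_nonneg _) (norm_nonneg _)).1 (by linarith)

theorem gammaField₁_properties [CompleteSpace H] [CompleteSpace L₁] [CompleteSpace L₂]
    {V : LinRel H H}
    (hΓ : IsUnitaryBoundaryPair V Γ) :
    ∃ γ₁ : ℂ → L₁ →L[ℂ] H,
      (∀ z ∈ unitDisk, (gammaField₁ Γ z).IsGraphOf (γ₁ z)) ∧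
      DifferentiableOn ℂ γ₁ unitDisk ∧
      ∀ z ∈ unitDisk, ∃ R : H →L[ℂ] H, (ext₁ Γ).IsResolventAt z R ∧
        ∀ μ ∈ unitDisk, γ₁ z = γ₁ μ + (z - μ) • R.comp (γ₁ μ) := by
  obtain ⟨T, F, G, D, hT, h⟩ := hΓ.exists_blocks
  replace h : HasBlocks Γ T F G D := h
  refine ⟨fun z => Ring.inverse (1 - z • T) ∘L F,
    fun z hz => h.isGraphOf_gammaField₁ (isUnit_one_sub_smul hT hz),
    (differentiableOn_inverse_one_sub hT).clm_comp (differentiableOn_const _),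
    fun z hz => ⟨_, h.isResolventAt_ext₁ (isUnit_one_sub_smul hT hz), fun μ hμ => ?_⟩⟩
  have e := inverse_sub_inverse (isUnit_one_sub_smul hT hz) (isUnit_one_sub_smul hT hμ)
  rw [← sub_eq_iff_eq_add', ← ContinuousLinearMap.sub_comp, e]
  have e2 : (1 - μ • T) - (1 - z • T) = (z - μ) • T := by rw [sub_smul]; abel
  rw [e2]
  ext u
  simp

theorem gammaField₂_properties [CompleteSpace H] [CompleteSpace L₁] [CompleteSpace L₂]
    {V : LinRel H H}
    (hΓ : IsUnitaryBoundaryPair V Γ) :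
    ∃ γ₂ : ℂ → L₂ →L[ℂ] H,
      (∀ z ∈ exteriorDisk, (gammaField₂ Γ z).IsGraphOf (γ₂ z)) ∧
      DifferentiableOn ℂ γ₂ exteriorDisk ∧
      ∀ z ∈ exteriorDisk, ∃ R : H →L[ℂ] H, (ext₂ Γ).IsResolventAt z R ∧
        ∀ μ ∈ exteriorDisk, γ₂ z = γ₂ μ + (z - μ) • R.comp (γ₂ μ) := by
  obtain ⟨T, F, G, D, hT, h⟩ := hΓ.flip.exists_blocks
  replace h : HasBlocks (flip Γ) T F G D := h
  refine ⟨fun z => Ring.inverse (z • (1 : H →L[ℂ] H) - T) ∘L F,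
    fun z hz => h.isGraphOf_gammaField₂ (isUnit_smul_one_sub hT hz),
    (differentiableOn_inverse_smul_sub hT).clm_comp (differentiableOn_const _),
    fun z hz => ⟨_, h.isResolventAt_ext₂ (isUnit_smul_one_sub hT hz), fun μ hμ => ?_⟩⟩
  have e := inverse_sub_inverse (isUnit_smul_one_sub hT hz) (isUnit_smul_one_sub hT hμ)
  rw [← sub_eq_iff_eq_add', ← ContinuousLinearMap.sub_comp, e]
  have e2 : (μ • (1 : H →L[ℂ] H) - T) - (z • (1 : H →L[ℂ] H) - T) = -((z - μ) • 1) := by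
    rw [sub_smul]; abel
  rw [e2]
  ext u
  simp

theorem exists_weylFunction [CompleteSpace H] [CompleteSpace L₁] [CompleteSpace L₂]
    {V : LinRel H H}
    (hΓ : IsUnitaryBoundaryPair V Γ) :
    ∃ Θ : ℂ → L₁ →L[ℂ] L₂,
      (∀ z ∈ unitDisk, (weylFamily Γ z).IsGraphOf (Θ z)) ∧ IsSchur Θ := by
  obtain ⟨T, F, G, D, hT, h⟩ := hΓ.exists_blocks
  replace h : HasBlocks Γ T F G D := h
  refine ⟨fun z => D + z • G ∘L Ring.inverse (1 - z • T) ∘L F,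
    fun z hz => h.isGraphOf_weylFamily (isUnit_one_sub_smul hT hz), ?_, ?_⟩
  · refine (differentiableOn_const _).add (differentiableOn_id.fun_smul ?_)
    exact (differentiableOn_const _).clm_comp
      ((differentiableOn_inverse_one_sub hT).clm_comp (differentiableOn_const _))
  · intro z hz
    refine ContinuousLinearMap.opNorm_le_bound _ zero_le_one fun u => ?_
    rw [one_mul]
    exact norm_weyl_le hΓ.isConservative (le_of_lt hz)
      ((h.mem_eigen_iff (isUnit_one_sub_smul hT hz)).2 ⟨rfl, rfl⟩)

theorem extensions_properties [CompleteSpace H] [CompleteSpace L₁] [CompleteSpace L₂]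
    {V : LinRel H H}
    (hΓ : IsUnitaryBoundaryPair V Γ) :
    (∃ T₁ : H →L[ℂ] H, (ext₁ Γ).inv.IsGraphOf T₁ ∧ ‖T₁‖ ≤ 1) ∧
      (∃ T₂ : H →L[ℂ] H, (ext₂ Γ).IsGraphOf T₂ ∧ ‖T₂‖ ≤ 1) ∧
      ext₂ Γ = (ext₁ Γ).inv.adjoint := by
  obtain ⟨T, F, G, D, hT, h⟩ := hΓ.exists_blocks
  obtain ⟨T', F', G', D', hT', h'⟩ := hΓ.flip.exists_blocks
  exact ⟨⟨T, HasBlocks.isGraphOf_ext₁_inv h, hT⟩, ⟨T', HasBlocks.isGraphOf_ext₂ h', hT'⟩,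
    ext₂_eq_adjoint hΓ.green h h'⟩

end BoundaryPair

/-! ### Nonnegativity of the kernel of a Schur function. -/

section SchurKernel

variable {L₁ L₂ : Type*}
  [NormedAddCommGroup L₁] [InnerProductSpace ℂ L₁] [CompleteSpace L₁]
  [NormedAddCommGroup L₂] [InnerProductSpace ℂ L₂] [CompleteSpace L₂]

open Real Metric

/-- On the unit circle the conjugated Szegő kernel is the Cauchy kernel, so the reproducing property
becomes the Cauchy integral formula. -/
theorem conj_one_sub_mul_conj_inv {z : ℂ} (hz : ‖z‖ = 1) (w : ℂ) :
    conj ((1 - z * conj w)⁻¹) = z / (z - w) := by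
  have h : z * conj z = 1 := by rw [Complex.mul_conj, Complex.normSq_eq_norm_sq, hz]; simp
  have hz0 : z ≠ 0 := fun h0 => by simp [h0] at h
  have e : z - w = z * (1 - conj z * w) := by linear_combination w * h
  rw [e, ← div_div, div_self hz0]
  simp

/-- The Szegő kernel reproduces values of functions holomorphic on the closed disk. -/
theorem circleAverage_szego {φ : ℂ → ℂ} (hφ : DiffContOnCl ℂ φ (ball 0 1)) {w : ℂ} (hw : ‖w‖ < 1) :
    circleAverage (fun z => conj ((1 - z * conj w)⁻¹) * φ z) 0 1 = φ w := by
  have h := DiffContOnCl.circleAverage_smul_div (c := 0) (R := 1) (f := φ) (w := w)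
    (by simpa using hφ) (by simpa using hw)
  rw [← h]
  refine circleAverage_congr_sphere fun z hz => ?_
  simp only [abs_one, mem_sphere, dist_zero_right] at hz
  simp [conj_one_sub_mul_conj_inv hz]


section Szego

variable {ι : Type*} [Fintype ι] {E : Type*} [NormedAddCommGroup E] [InnerProductSpace ℂ E]

/-- The linear combination of Szegő kernels at the points `w i` with coefficients `a i`. -/
def szegoSum (w : ι → ℂ) (a : ι → E) (z : ℂ) : E := ∑ i, (1 - z * conj (w i))⁻¹ • a i

theorem one_sub_mul_conj_ne_zero {z w : ℂ} (hz : ‖z‖ ≤ 1) (hw : ‖w‖ < 1) : 1 - z * conj w ≠ 0 := by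
  intro h
  have h1 : ‖z * conj w‖ = 1 := by rw [← sub_eq_zero.1 h]; simp
  rw [norm_mul, RCLike.norm_conj] at h1
  nlinarith [norm_nonneg z, norm_nonneg w]

theorem diffContOnCl_szegoSum {w : ι → ℂ} (hw : ∀ i, ‖w i‖ < 1) (a : ι → E) :
    DiffContOnCl ℂ (szegoSum w a) (ball 0 1) := by
  have hd : ∀ z ∈ closedBall (0 : ℂ) 1, DifferentiableAt ℂ (szegoSum w a) z := by
    intro z hz
    unfold szegoSum
    refine DifferentiableAt.fun_sum fun i _ => DifferentiableAt.smul_const ?_ _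
    exact DifferentiableAt.fun_inv (by fun_prop)
      (one_sub_mul_conj_ne_zero (by simpa using hz) (hw i))
  refine ⟨fun z hz => (hd z (ball_subset_closedBall hz)).differentiableWithinAt, fun z hz => ?_⟩
  rw [closure_ball _ one_ne_zero] at hz
  exact (hd z hz).continuousAt.continuousWithinAt

theorem inner_szegoSum (w : ι → ℂ) (a : ι → E) (z : ℂ) (x : E) :
    inner ℂ (szegoSum w a z) x = ∑ i, conj ((1 - z * conj (w i))⁻¹) * inner ℂ (a i) x := by
  simp only [szegoSum, sum_inner, inner_smul_left]

theorem circleIntegrable_inner {f g : ℂ → E} (hf : DiffContOnCl ℂ f (ball 0 1))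
    (hg : DiffContOnCl ℂ g (ball 0 1)) :
    CircleIntegrable (fun z => (inner ℂ (f z) (g z) : ℂ)) 0 1 := by
  refine ContinuousOn.circleIntegrable zero_le_one ?_
  have hs : sphere (0 : ℂ) 1 ⊆ closedBall 0 1 := sphere_subset_closedBall
  exact (hf.continuousOn_ball.mono hs).inner (𝕜 := ℂ) (hg.continuousOn_ball.mono hs)

theorem circleAverage_inner_szegoSum {w : ι → ℂ} (hw : ∀ i, ‖w i‖ < 1) (a : ι → E) {ψ : ℂ → E}
    (hψ : DiffContOnCl ℂ ψ (ball 0 1)) :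
    circleAverage (fun z => (inner ℂ (szegoSum w a z) (ψ z) : ℂ)) 0 1 =
      ∑ i, inner ℂ (a i) (ψ (w i)) := by
  have hφ : ∀ i, DiffContOnCl ℂ (fun z => (inner ℂ (a i) (ψ z) : ℂ)) (ball 0 1) := fun i =>
    (innerSL ℂ (a i)).differentiable.comp_diffContOnCl hψ
  simp only [inner_szegoSum]
  rw [circleAverage_fun_sum]
  · exact Finset.sum_congr rfl fun i _ => circleAverage_szego (hφ i) (hw i)
  · intro i _
    refine ContinuousOn.circleIntegrable zero_le_one ?_
    have hs : sphere (0 : ℂ) 1 ⊆ closedBall 0 1 := sphere_subset_closedBall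
    refine ContinuousOn.mul ?_ ((hφ i).continuousOn_ball.mono hs)
    refine Complex.continuous_conj.comp_continuousOn (ContinuousOn.inv₀ (by fun_prop) ?_)
    intro z hz
    exact one_sub_mul_conj_ne_zero (by simpa using hs hz) (hw i)

end Szego

/-- The quadratic form of the kernel of a contractive function holomorphic up to the boundary is
nonnegative. -/
theorem schurKernel_nonneg_of_diffContOnCl {s : ℂ → L₁ →L[ℂ] L₂}
    (hs : DiffContOnCl ℂ s (ball 0 1)) (hc : ∀ z, ‖z‖ = 1 → ‖s z‖ ≤ 1)
    {ι : Type*} [Fintype ι] {w : ι → ℂ} (hw : ∀ i, ‖w i‖ < 1) (f : ι → L₂) :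
    0 ≤ (∑ i, ∑ j, (inner ℂ (f i) (schurKernel s (w i) (w j) (f j)) : ℂ)).re := by
  set a : ι → L₁ := fun j => ContinuousLinearMap.adjoint (s (w j)) (f j) with ha
  set g := szegoSum w f
  set h := szegoSum w a
  have hg : DiffContOnCl ℂ g (ball 0 1) := diffContOnCl_szegoSum hw f
  have hh : DiffContOnCl ℂ h (ball 0 1) := diffContOnCl_szegoSum hw a
  have hsh : DiffContOnCl ℂ (fun z => s z (h z)) (ball 0 1) :=
    ⟨hs.1.clm_apply hh.1, hs.2.clm_apply hh.2⟩
  have eB := circleAverage_inner_szegoSum hw f hg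
  have eA := circleAverage_inner_szegoSum hw f hsh
  have eA' := circleAverage_inner_szegoSum hw a hh
  -- In the Hardy space `h` is the adjoint of multiplication by `s` applied to `g`, so `⟨g, s h⟩ =
  -- ‖h‖²`, while the kernel form is `‖g‖² - ⟨g, s h⟩`.
  have hAA : ∑ i, inner ℂ (a i) (h (w i)) = (∑ i, inner ℂ (f i) (s (w i) (h (w i))) : ℂ) :=
    Finset.sum_congr rfl fun i _ => by rw [ha, ContinuousLinearMap.adjoint_inner_left]
  have hsum : ∑ i, ∑ j, (inner ℂ (f i) (schurKernel s (w i) (w j) (f j)) : ℂ) =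
      ∑ i, inner ℂ (f i) (g (w i)) - ∑ i, inner ℂ (f i) (s (w i) (h (w i))) := by
    rw [← Finset.sum_sub_distrib]
    refine Finset.sum_congr rfl fun i _ => ?_
    rw [← inner_sub_right, ← inner_sum]
    congr 1
    simp only [g, h, szegoSum, map_sum, ← Finset.sum_sub_distrib]
    refine Finset.sum_congr rfl fun j _ => ?_
    simp [schurKernel, ha, smul_sub]
  have hre : ∀ {φ : ℂ → ℂ}, CircleIntegrable φ 0 1 →
      circleAverage (fun z => (φ z).re) 0 1 = (circleAverage φ 0 1).re := fun hφ =>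
    Complex.reCLM.circleAverage_comp_comm hφ
  have iB := circleIntegrable_inner hg hg
  have iA := circleIntegrable_inner hg hsh
  have iA' := circleIntegrable_inner hh hh
  -- The real part of the integrand is at least `‖g - s h‖²`, because `‖s h‖ ≤ ‖h‖` on the circle.
  -- The second bracket averages to zero by `hAA`, which leaves the kernel form.
  have key : 0 ≤ circleAverage (fun z => ((inner ℂ (g z) (g z) - inner ℂ (g z) (s z (h z))) +
      (inner ℂ (h z) (h z) - inner ℂ (g z) (s z (h z))) : ℂ).re) 0 1 := by
    refine circleAverage_nonneg_of_nonneg fun z hz => ?_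
    have hz1 : ‖z‖ = 1 := by simpa using hz
    have h1 : ‖s z (h z)‖ ≤ ‖h z‖ := by simpa using (s z).le_of_opNorm_le (hc z hz1) (h z)
    have h2 := norm_sub_sq (𝕜 := ℂ) (g z) (s z (h z))
    have e1 : (inner ℂ (g z) (g z) : ℂ).re = ‖g z‖ ^ 2 := inner_self_eq_norm_sq (𝕜 := ℂ) _
    have e2 : (inner ℂ (h z) (h z) : ℂ).re = ‖h z‖ ^ 2 := inner_self_eq_norm_sq (𝕜 := ℂ) _
    simp only [Complex.add_re, Complex.sub_re, e1, e2]
    simp only [RCLike.re_to_complex] at h2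
    nlinarith [sq_nonneg ‖g z - s z (h z)‖, norm_nonneg (s z (h z)), norm_nonneg (h z)]
  have key := key.trans_eq (hre ((iB.sub iA).add (iA'.sub iA)))
  have iBA : CircleIntegrable
      (fun z => (inner ℂ (g z) (g z) - inner ℂ (g z) (s z (h z)) : ℂ)) 0 1 := iB.sub iA
  have iAA : CircleIntegrable
      (fun z => (inner ℂ (h z) (h z) - inner ℂ (g z) (s z (h z)) : ℂ)) 0 1 := iA'.sub iA
  rw [circleAverage_fun_add iBA iAA, circleAverage_fun_sub iB iA,
    circleAverage_fun_sub iA' iA, eB, eA, eA', hAA, sub_self, add_zero] at key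
  rwa [hsum]

/-- The dilations `s(r z)` with `0 < r < 1` are holomorphic beyond the closed disk, so the previous
case applies. The form is continuous in `r`, and `r → 1` from below. -/
theorem IsSchur.schurKernel_nonneg {s : ℂ → L₁ →L[ℂ] L₂} (hs : IsSchur s)
    {ι : Type*} [Fintype ι] {w : ι → ℂ} (hw : ∀ i, ‖w i‖ < 1) (f : ι → L₂) :
    0 ≤ (∑ i, ∑ j, (inner ℂ (f i) (schurKernel s (w i) (w j) (f j)) : ℂ)).re := by
  let q : ℝ → ℝ := fun r => (∑ i, ∑ j, (inner ℂ (f i) ((1 - w i * conj (w j))⁻¹ •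
    (f j - s (r * w i) (ContinuousLinearMap.adjoint (s (r * w j)) (f j)))) : ℂ)).re
  have hscont : ∀ {z}, ‖z‖ < 1 → ContinuousAt s z := fun {z} hz =>
    (hs.holomorphic.differentiableAt
      ((isOpen_lt continuous_norm continuous_const).mem_nhds hz)).continuousAt
  have hq : ContinuousAt q 1 := by
    have h1 : ∀ i, ContinuousAt (fun r : ℝ => s (r * w i)) 1 := fun i => by
      refine ContinuousAt.comp (f := fun r : ℝ => (r * w i : ℂ)) ?_ (by fun_prop)
      simpa using hscont (hw i)
    refine Complex.continuous_re.continuousAt.comp ?_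
    refine tendsto_finsetSum _ fun i _ => tendsto_finsetSum _ fun j _ => ?_
    refine ContinuousAt.inner (𝕜 := ℂ) continuousAt_const (ContinuousAt.const_smul ?_ _)
    refine continuousAt_const.sub ((h1 i).clm_apply (ContinuousAt.clm_apply ?_ continuousAt_const))
    exact ContinuousLinearMap.adjoint.continuous.continuousAt.comp (h1 j)
  have hpos : ∀ r ∈ Set.Ioo (0 : ℝ) 1, 0 ≤ q r := by
    intro r hr
    have hlt : ∀ {z : ℂ}, ‖z‖ ≤ 1 → ‖(r * z : ℂ)‖ < 1 := fun {z} hz => by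
      rw [norm_mul, Complex.norm_real, Real.norm_of_nonneg hr.1.le]
      nlinarith [hr.1, hr.2, norm_nonneg z]
    have hd : ∀ z ∈ closedBall (0 : ℂ) 1, DifferentiableAt ℂ (fun z => s (r * z)) z := by
      intro z hz
      refine DifferentiableAt.comp z (g := s) (f := fun z : ℂ => (r * z : ℂ)) ?_ (by fun_prop)
      exact hs.holomorphic.differentiableAt ((isOpen_lt continuous_norm continuous_const).mem_nhds
        (hlt (by simpa using hz)))
    refine schurKernel_nonneg_of_diffContOnCl (s := fun z => s (r * z)) ⟨?_, ?_⟩ ?_ hw f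
    · exact fun z hz => (hd z (ball_subset_closedBall hz)).differentiableWithinAt
    · intro z hz
      rw [closure_ball _ one_ne_zero] at hz
      exact (hd z hz).continuousAt.continuousWithinAt
    · exact fun z hz => hs.contractive _ (hlt hz.le)
  have hlim : Filter.Tendsto q (nhdsWithin 1 (Set.Iio 1)) (nhds (q 1)) :=
    hq.tendsto.mono_left nhdsWithin_le_nhds
  have h1 : 0 ≤ q 1 := by
    refine ge_of_tendsto hlim ?_
    filter_upwards [Ioo_mem_nhdsLT (zero_lt_one' ℝ)] with r hr using hpos r hr
  simpa [q, schurKernel] using h1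

theorem inner_schurKernel_conj (s : ℂ → L₁ →L[ℂ] L₂) (z w : ℂ) (f g : L₂) :
    conj (inner ℂ g (schurKernel s w z f)) = (inner ℂ f (schurKernel s z w g) : ℂ) := by
  rw [inner_conj_symm]
  simp [schurKernel, inner_smul_left, inner_sub_left, ← ContinuousLinearMap.adjoint_inner_left, mul_comm]

theorem IsSchur.isSchurKernelOn {s : ℂ → L₁ →L[ℂ] L₂} (hs : IsSchur s) :
    IsSchurKernelOn unitDisk s := by
  refine ⟨hs.holomorphic, fun n ω f hω => ?_⟩
  have hH : (Matrix.of fun i j : Fin n =>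
      (inner ℂ (f i) (schurKernel s (ω i) (ω j) (f j)) : ℂ)).IsHermitian :=
    Matrix.IsHermitian.ext fun i j => inner_schurKernel_conj s _ _ _ _
  refine Matrix.PosSemidef.of_dotProduct_mulVec_nonneg hH fun x => ?_
  rw [RCLike.nonneg_iff (K := ℂ)]
  refine ⟨?_, hH.im_star_dotProduct_mulVec_self x⟩
  -- The scalar coefficients of the matrix form are absorbed into the vectors.
  have := hs.schurKernel_nonneg hω (fun i => x i • f i)
  simp only [map_smul, inner_smul_left, inner_smul_right] at this
  simpa only [dotProduct, Matrix.mulVec, Finset.mul_sum, Matrix.of_apply, Pi.star_apply,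
    RCLike.star_def, mul_comm (x _), mul_assoc, RCLike.re_to_complex] using this

end SchurKernel

/-! ### The shift on square summable sequences. -/

section Shift

/-- Square summable sequences in `E`. -/
abbrev SquareSummable (E : Type*) [NormedAddCommGroup E] := lp (fun _ : ℕ => E) 2

variable {E : Type*} [NormedAddCommGroup E]

theorem memℓp_two_iff {m : ℕ → E} : Memℓp m 2 ↔ Summable fun n => ‖m n‖ ^ 2 := by
  rw [memℓp_gen_iff (by norm_num)]
  simp

theorem SquareSummable.hasSum (m : SquareSummable E) : HasSum (fun n => ‖m n‖ ^ 2) (‖m‖ ^ 2) := by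
  have h := lp.hasSum_norm (p := 2) (by norm_num) m
  simpa using h

variable [InnerProductSpace ℂ E]

/-- Prepending a term identifies `E × ℓ²(E)` with `ℓ²(E)`. -/
def SquareSummable.cons (E : Type*) [NormedAddCommGroup E] [InnerProductSpace ℂ E] :
    (E × SquareSummable E) ≃ₗ[ℂ] SquareSummable E where
  toFun p := ⟨fun n => Nat.casesOn n p.1 p.2, memℓp_two_iff.2 <| by
    rw [← summable_nat_add_iff 1]
    exact (SquareSummable.hasSum p.2).summable⟩
  map_add' p q := by
    ext n
    cases n <;> rfl
  map_smul' c p := by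
    ext n
    cases n <;> rfl
  invFun m := (m 0, ⟨fun n => m (n + 1), memℓp_two_iff.2 <|
    (summable_nat_add_iff 1).2 (SquareSummable.hasSum m).summable⟩)
  left_inv p := by
    ext <;> rfl
  right_inv m := by
    ext n
    cases n <;> rfl

theorem SquareSummable.norm_cons_sq (p : E × SquareSummable E) :
    ‖SquareSummable.cons E p‖ ^ 2 = ‖p.1‖ ^ 2 + ‖p.2‖ ^ 2 := by
  have h := SquareSummable.hasSum (SquareSummable.cons E p)
  have h2 := (hasSum_nat_add_iff' 1).2 h
  have h3 := (SquareSummable.hasSum p.2).unique h2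
  rw [h3]
  simp [SquareSummable.cons]

end Shift

/-! ### Extending a conservative relation to a unitary one. -/

namespace BoundaryPair

variable {H L₁ L₂ : Type*}
  [NormedAddCommGroup H] [InnerProductSpace ℂ H]
  [NormedAddCommGroup L₁] [InnerProductSpace ℂ L₁]
  [NormedAddCommGroup L₂] [InnerProductSpace ℂ L₂]

section GreenOrthogonal

theorem greenIdentity_comm {p q : (H × H) × (L₁ × L₂)} :
    GreenIdentity p q ↔ GreenIdentity q p := by
  unfold GreenIdentity
  rw [← (starRingEnd ℂ).injective.eq_iff]
  simp

/-- The elements that satisfy the Green identity with all elements of a set. -/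
def greenOrthogonal (S : Set ((H × H) × (L₁ × L₂))) : LinRel (H × H) (L₁ × L₂) where
  carrier := {q | ∀ p ∈ S, GreenIdentity p q}
  zero_mem' p _ := by simp [GreenIdentity]
  add_mem' {q r} hq hr p hp := by
    have e1 := hq p hp
    have e2 := hr p hp
    simp only [GreenIdentity, Prod.fst_add, Prod.snd_add, inner_add_left] at e1 e2 ⊢
    linear_combination e1 + e2
  smul_mem' c q hq p hp := by
    have e1 := hq p hp
    simp only [GreenIdentity, Prod.smul_fst, Prod.smul_snd, inner_smul_left] at e1 ⊢
    linear_combination conj c * e1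

theorem isClosed_greenOrthogonal (S : Set ((H × H) × (L₁ × L₂))) :
    IsClosed (greenOrthogonal S : Set ((H × H) × (L₁ × L₂))) := by
  have : (greenOrthogonal S : Set ((H × H) × (L₁ × L₂))) = ⋂ p ∈ S, {q | GreenIdentity p q} := by
    ext q
    simp only [Set.mem_iInter, Set.mem_ofPred_eq]
    rfl
  rw [this]
  exact isClosed_biInter fun p _ => isClosed_setOf_greenIdentity p

/-- Green orthogonals are closed subspaces, so the closed span lies in the orthogonal of `S`. By
symmetry `S` lies in the orthogonal of the closed span, and the same argument applies once more. -/
theorem green_topologicalClosure_span {S : Set ((H × H) × (L₁ × L₂))}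
    (hS : ∀ p ∈ S, ∀ q ∈ S, GreenIdentity p q) :
    ∀ p ∈ (Submodule.span ℂ S).topologicalClosure, ∀ q ∈ (Submodule.span ℂ S).topologicalClosure,
      GreenIdentity p q := by
  have hle : ∀ S' : Set ((H × H) × (L₁ × L₂)), S ⊆ greenOrthogonal S' →
      (Submodule.span ℂ S).topologicalClosure ≤ greenOrthogonal S' := fun S' h =>
    Submodule.topologicalClosure_minimal _ (Submodule.span_le.2 h) (isClosed_greenOrthogonal S')
  have h1 := hle S fun q hq p hp => hS p hp q hq
  have h2 := hle (Submodule.span ℂ S).topologicalClosure fun q hq p hp =>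
    greenIdentity_comm.1 (h1 hp q hq)
  exact fun p hp q hq => h2 hq p hp

end GreenOrthogonal

section Extension

variable (Γ : LinRel (H × H) (L₁ × L₂))

/-- The defect space of the relation `{f', u₁} ↦ {f, u₂}` at the source. -/
abbrev sourceDefect : Submodule ℂ (WithLp 2 (H × L₁)) :=
  ((transfer Γ).map (LinearMap.fst ℂ _ _))ᗮ

/-- The defect space of the relation `{f', u₁} ↦ {f, u₂}` at the target. -/
abbrev targetDefect : Submodule ℂ (WithLp 2 (H × L₂)) :=
  ((transfer Γ).map (LinearMap.snd ℂ _ _))ᗮ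

/-- The space in which a conservative relation extends to a unitary boundary pair. -/
abbrev ExtensionSpace : Type _ :=
  WithLp 2 (H × WithLp 2 (SquareSummable (sourceDefect Γ) × SquareSummable (targetDefect Γ)))

/-- The extension of a conservative relation: the source defect is absorbed by a forward shift,
the target defect is supplied by a backward shift. -/
def unitaryExtension :
    LinRel (ExtensionSpace Γ × ExtensionSpace Γ) (L₁ × L₂) where
  carrier := {p | ∃ d r, (d, r) ∈ transfer Γ ∧ ∃ (α : sourceDefect Γ) (β : targetDefect Γ),
    (p.1.2.fst = d.fst + (α : WithLp 2 (H × L₁)).fst ∧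
      p.2.1 = d.snd + (α : WithLp 2 (H × L₁)).snd) ∧
    (p.1.1.fst = r.fst + (β : WithLp 2 (H × L₂)).fst ∧
      p.2.2 = r.snd + (β : WithLp 2 (H × L₂)).snd) ∧
    p.1.1.snd.fst = SquareSummable.cons _ (α, p.1.2.snd.fst) ∧
    p.1.2.snd.snd = SquareSummable.cons _ (β, p.1.1.snd.snd)}
  zero_mem' := ⟨0, 0, zero_mem _, 0, 0, by simp, by simp,
    ((SquareSummable.cons _).map_zero).symm, ((SquareSummable.cons _).map_zero).symm⟩
  add_mem' := by
    rintro p q ⟨d, r, hdr, α, β, ⟨h1, h2⟩, ⟨h3, h4⟩, h5, h6⟩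
      ⟨d', r', hdr', α', β', ⟨h1', h2'⟩, ⟨h3', h4'⟩, h5', h6'⟩
    refine ⟨d + d', r + r', add_mem hdr hdr', α + α', β + β', ⟨?_, ?_⟩, ⟨?_, ?_⟩, ?_, ?_⟩
    · simp only [Prod.fst_add, Prod.snd_add, WithLp.add_fst, h1, h1', Submodule.coe_add]; abel
    · simp only [Prod.fst_add, Prod.snd_add, WithLp.add_snd, h2, h2', Submodule.coe_add]; abel
    · simp only [Prod.fst_add, WithLp.add_fst, h3, h3', Submodule.coe_add]; abel
    · simp only [Prod.snd_add, WithLp.add_snd, h4, h4', Submodule.coe_add]; abel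
    · simp only [Prod.fst_add, Prod.snd_add, WithLp.add_fst, WithLp.add_snd, h5, h5']
      rw [← map_add]; rfl
    · simp only [Prod.fst_add, Prod.snd_add, WithLp.add_snd, h6, h6']
      rw [← map_add]; rfl
  smul_mem' := by
    rintro c p ⟨d, r, hdr, α, β, ⟨h1, h2⟩, ⟨h3, h4⟩, h5, h6⟩
    refine ⟨c • d, c • r, Submodule.smul_mem _ c hdr, c • α, c • β, ⟨?_, ?_⟩, ⟨?_, ?_⟩, ?_, ?_⟩
    · simp only [Prod.smul_fst, Prod.smul_snd, WithLp.smul_fst, h1, Submodule.coe_smul, smul_add]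
    · simp only [Prod.smul_fst, Prod.smul_snd, WithLp.smul_snd, h2, Submodule.coe_smul, smul_add]
    · simp only [Prod.smul_fst, WithLp.smul_fst, h3, Submodule.coe_smul, smul_add]
    · simp only [Prod.smul_snd, WithLp.smul_snd, h4, Submodule.coe_smul, smul_add]
    · simp only [Prod.smul_fst, Prod.smul_snd, WithLp.smul_fst, WithLp.smul_snd, h5]
      rw [← map_smul]; rfl
    · simp only [Prod.smul_fst, Prod.smul_snd, WithLp.smul_snd, h6]
      rw [← map_smul]; rfl

/-- The embedding into the extension space. -/
def toExtension (f : H) : ExtensionSpace Γ := WithLp.toLp 2 (f, 0)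

variable {Γ}

theorem mem_unitaryExtension {f f' : H} {u₁ : L₁} {u₂ : L₂} (h : ((f, f'), (u₁, u₂)) ∈ Γ) :
    ((toExtension Γ f, toExtension Γ f'), (u₁, u₂)) ∈ unitaryExtension Γ :=
  ⟨WithLp.toLp 2 (f', u₁), WithLp.toLp 2 (f, u₂), h, 0, 0, by simp [toExtension],
    by simp [toExtension], ((SquareSummable.cons _).map_zero).symm,
    ((SquareSummable.cons _).map_zero).symm⟩

theorem norm_fst_add_sq {E F : Type*} [NormedAddCommGroup E] [InnerProductSpace ℂ E]
    [NormedAddCommGroup F] [InnerProductSpace ℂ F] {x y : WithLp 2 (E × F)}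
    (h : inner ℂ x y = 0) :
    ‖x.fst + y.fst‖ ^ 2 + ‖x.snd + y.snd‖ ^ 2 = ‖x‖ ^ 2 + ‖y‖ ^ 2 := by
  rw [← WithLp.add_fst, ← WithLp.add_snd, ← WithLp.prod_norm_sq_eq_of_L2, sq, sq, sq,
    norm_add_sq_eq_norm_sq_add_norm_sq_of_inner_eq_zero _ _ h]

/-- Pythagoras: the norm of `α` enters with `{f', u₁}` and leaves as the new head of the first
sequence, while the norm of `β` is the head lost by the second sequence and leaves with `{f, u₂}`.
-/
theorem IsConservative.unitaryExtension (h : IsConservative Γ) :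
    IsConservative (unitaryExtension Γ) := by
  rintro f f' u₁ u₂ ⟨d, r, hdr, α, β, ⟨h1, h2⟩, ⟨h3, h4⟩, h5, h6⟩
  have e1 := norm_fst_add_sq (Submodule.inner_right_of_mem_orthogonal
    (Submodule.mem_map_of_mem hdr : d ∈ (transfer Γ).map (LinearMap.fst ℂ _ _)) α.2)
  have e2 := norm_fst_add_sq (Submodule.inner_right_of_mem_orthogonal
    (Submodule.mem_map_of_mem hdr : r ∈ (transfer Γ).map (LinearMap.snd ℂ _ _)) β.2)
  have e3 := h.norm_eq hdr
  have e5 := SquareSummable.norm_cons_sq (α, f'.snd.fst)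
  have e6 := SquareSummable.norm_cons_sq (β, f.snd.snd)
  simp only at h1 h2 h3 h4 h5 h6 e5 e6
  simp only [LinearMap.fst_apply] at e1
  simp only [LinearMap.snd_apply] at e2
  rw [← h1, ← h2] at e1
  rw [← h3, ← h4, e3] at e2
  rw [← h5] at e5
  rw [← h6] at e6
  rw [WithLp.prod_norm_sq_eq_of_L2, WithLp.prod_norm_sq_eq_of_L2 f.snd,
    WithLp.prod_norm_sq_eq_of_L2 f', WithLp.prod_norm_sq_eq_of_L2 f'.snd]
  rw [Submodule.coe_norm] at e5 e6
  linarith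

variable [CompleteSpace H] [CompleteSpace L₁] [CompleteSpace L₂]

/-- A closed conservative relation extends to a unitary boundary pair in a larger space. -/
theorem IsConservative.isUnitaryBoundaryPair_unitaryExtension (h : IsConservative Γ)
    (hc : IsClosed (Γ : Set ((H × H) × (L₁ × L₂)))) :
    IsUnitaryBoundaryPair (BoundaryPair.unitaryExtension Γ).ker
      (BoundaryPair.unitaryExtension Γ) := by
  have hcl : IsClosed (transfer Γ : Set (WithLp 2 (H × L₁) × WithLp 2 (H × L₂))) :=
    isClosed_transfer hc
  have hs : IsClosed ((transfer Γ).map (LinearMap.fst ℂ _ _) : Set (WithLp 2 (H × L₁))) :=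
    LinRel.isClosed_map_fst hcl fun x y hxy => (h.norm_eq hxy).le
  have ht : IsClosed ((transfer Γ).map (LinearMap.snd ℂ _ _) : Set (WithLp 2 (H × L₂))) := by
    have e : (transfer Γ).map (LinearMap.snd ℂ _ _) =
        (transfer Γ).inv.map (LinearMap.fst ℂ _ _) := by
      ext r
      simp [LinRel.mem_inv]
    rw [e]
    exact LinRel.isClosed_map_fst (LinRel.isClosed_inv hcl) fun x y hxy =>
      (h.norm_eq (LinRel.mem_inv.1 hxy)).ge
  have : CompleteSpace ((transfer Γ).map (LinearMap.fst ℂ _ _)) := hs.completeSpace_coe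
  have : CompleteSpace ((transfer Γ).map (LinearMap.snd ℂ _ _)) := ht.completeSpace_coe
  refine h.unitaryExtension.isUnitaryBoundaryPair ?_ ?_
  · intro f' u₁
    obtain ⟨d', hd, α, hα, e⟩ := Submodule.exists_add_mem_mem_orthogonal
      (K := (transfer Γ).map (LinearMap.fst ℂ _ _)) (WithLp.toLp 2 (f'.fst, u₁))
    obtain ⟨⟨d, r⟩, hdr, rfl⟩ := hd
    -- The head of the second sequence is the target defect vector to be emitted, and the tail stays
    -- in the state.
    obtain ⟨⟨β, n⟩, hn⟩ := (SquareSummable.cons (targetDefect Γ)).surjective f'.snd.snd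
    refine ⟨WithLp.toLp 2 (r.fst + (β : WithLp 2 (H × L₂)).fst,
      WithLp.toLp 2 (SquareSummable.cons _ (⟨α, hα⟩, f'.snd.fst), n)),
      r.snd + (β : WithLp 2 (H × L₂)).snd, d, r, hdr, ⟨α, hα⟩, β, ⟨?_, ?_⟩, ⟨rfl, rfl⟩, rfl, hn.symm⟩
    · exact congrArg WithLp.fst e
    · exact congrArg WithLp.snd e
  · intro f u₂
    obtain ⟨r', hr, β, hβ, e⟩ := Submodule.exists_add_mem_mem_orthogonal
      (K := (transfer Γ).map (LinearMap.snd ℂ _ _)) (WithLp.toLp 2 (f.fst, u₂))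
    obtain ⟨⟨d, r⟩, hdr, rfl⟩ := hr
    obtain ⟨⟨α, n⟩, hn⟩ := (SquareSummable.cons (sourceDefect Γ)).surjective f.snd.fst
    refine ⟨WithLp.toLp 2 (d.fst + (α : WithLp 2 (H × L₁)).fst,
      WithLp.toLp 2 (n, SquareSummable.cons _ (⟨β, hβ⟩, f.snd.snd))),
      d.snd + (α : WithLp 2 (H × L₁)).snd, d, r, hdr, α, ⟨β, hβ⟩, ⟨rfl, rfl⟩, ⟨?_, ?_⟩, hn.symm, rfl⟩
    · exact congrArg WithLp.fst e
    · exact congrArg WithLp.snd e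

end Extension

end BoundaryPair

/-! ### Compression to the simple part. -/

namespace BoundaryPair

variable {H L₁ L₂ : Type*}
  [NormedAddCommGroup H] [InnerProductSpace ℂ H]
  [NormedAddCommGroup L₁] [InnerProductSpace ℂ L₁]
  [NormedAddCommGroup L₂] [InnerProductSpace ℂ L₂]

section SimplePart

variable (Γ : LinRel (H × H) (L₁ × L₂))

/-- The vectors `f` with `{(f, z f), u} ∈ Γ` for some `u` and some `z ≠ 0` off the unit circle. -/
def eigenvectors : Set H :=
  {f | ∃ z : ℂ, z ≠ 0 ∧ ‖z‖ ≠ 1 ∧ ∃ (u₁ : L₁) (u₂ : L₂), ((f, z • f), (u₁, u₂)) ∈ Γ}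

/-- The closed span of the eigenvectors: the state space of the simple part. -/
def eigenSpan : Submodule ℂ H := (Submodule.span ℂ (eigenvectors Γ)).topologicalClosure

/-- The restriction of a relation to a subspace of the state space. -/
def restrict (N : Submodule ℂ H) : LinRel (N × N) (L₁ × L₂) :=
  Γ.comap ((N.subtype.prodMap N.subtype).prodMap LinearMap.id)

variable {Γ}

theorem mem_restrict {N : Submodule ℂ H} {f f' : N} {u : L₁ × L₂} :
    ((f, f'), u) ∈ restrict Γ N ↔ (((f : H), (f' : H)), u) ∈ Γ := Iff.rfl

theorem subset_eigenSpan : eigenvectors Γ ⊆ eigenSpan Γ :=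
  Submodule.subset_span.trans (Submodule.le_topologicalClosure _)

theorem isClosed_eigenSpan : IsClosed (eigenSpan Γ : Set H) :=
  Submodule.isClosed_topologicalClosure _

/-- Flipping sends `(f, z f)` to `(z f, z⁻¹ (z f))`, an eigenvector at `z⁻¹`. This symmetry is why
`z = 0` is excluded from `eigenvectors`. -/
theorem eigenSpan_flip_le : eigenSpan (flip Γ) ≤ eigenSpan Γ := by
  refine Submodule.topologicalClosure_minimal _ (Submodule.span_le.2 ?_) isClosed_eigenSpan
  rintro f ⟨z, hz, hz1, u₂, u₁, hf⟩
  have hzf : z • f ∈ eigenvectors Γ :=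
    ⟨z⁻¹, inv_ne_zero hz, by simpa using hz1, u₁, u₂, by
      rw [smul_smul, inv_mul_cancel₀ hz, one_smul]; exact mem_flip.1 hf⟩
  have := (eigenSpan Γ).smul_mem z⁻¹ (subset_eigenSpan hzf)
  rwa [smul_smul, inv_mul_cancel₀ hz, one_smul] at this

theorem eigenSpan_flip : eigenSpan (flip Γ) = eigenSpan Γ :=
  le_antisymm eigenSpan_flip_le (eigenSpan_flip_le (Γ := flip Γ))

theorem IsConservative.restrict (h : IsConservative Γ) (N : Submodule ℂ H) :
    IsConservative (restrict Γ N) := fun _ _ _ _ hf => h _ _ _ _ (mem_restrict.1 hf)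

/-- Eigenvectors of the relation lie in the defect subspaces of its kernel. -/
theorem mem_defect_of_mem (green : ∀ p ∈ Γ, ∀ q ∈ Γ, GreenIdentity p q) {z : ℂ} {f : H}
    {u : L₁ × L₂} (hf : ((f, z • f), u) ∈ Γ) : f ∈ LinRel.defect Γ.ker z := by
  rw [LinRel.defect, Submodule.mem_orthogonal]
  rintro _ ⟨⟨g, k⟩, hgk, rfl⟩
  obtain ⟨g', hg, rfl⟩ := LinRel.mem_oneSubSmul.1 hgk
  have e := green _ hf _ (LinRel.mem_ker.1 hg)
  simpa [GreenIdentity, inner_sub_left, inner_smul_left, inner_smul_right] using e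

theorem _root_.LinRel.IsClosedIsometricOperator.norm_eq_one {V : LinRel H H}
    (h : V.IsClosedIsometricOperator) {z : ℂ} (hz : z ∈ V.pointSpectrum) : ‖z‖ = 1 := by
  obtain ⟨f, hf, hzf⟩ := hz
  have e := h.isometric _ _ hzf
  rw [norm_smul] at e
  exact mul_right_cancel₀ (norm_ne_zero_iff.2 hf) (by rw [e, one_mul])

variable [CompleteSpace H]

/-- The excluded point `z = 0` is recovered as a limit: `F u` is the limit of the eigenvectors `(1 -
zT)⁻¹ F u` as `z → 0` with `z ≠ 0`. -/
theorem HasBlocks.range_le_eigenSpan {T : H →L[ℂ] H} {F : L₁ →L[ℂ] H} {G : H →L[ℂ] L₂}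
    {D : L₁ →L[ℂ] L₂} (h : HasBlocks Γ T F G D) (hT : ‖T‖ ≤ 1) (u : L₁) :
    F u ∈ eigenSpan Γ := by
  have hc : ContinuousAt (fun z : ℂ => Ring.inverse (1 - z • T) (F u)) 0 := by
    refine ContinuousAt.clm_apply ?_ continuousAt_const
    exact ((differentiableOn_inverse_one_sub hT).differentiableAt
      ((isOpen_lt continuous_norm continuous_const).mem_nhds (by simp))).continuousAt
  have hlim : Filter.Tendsto (fun z : ℂ => Ring.inverse (1 - z • T) (F u)) (nhdsWithin 0 {0}ᶜ)
      (nhds (F u)) := by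
    have := hc.tendsto.mono_left (nhdsWithin_le_nhds (s := {0}ᶜ))
    simpa using this
  refine isClosed_eigenSpan.mem_of_tendsto hlim ?_
  have hball : ∀ᶠ z : ℂ in nhdsWithin 0 {0}ᶜ, ‖z‖ < 1 :=
    nhdsWithin_le_nhds ((isOpen_lt continuous_norm continuous_const).mem_nhds (by simp))
  filter_upwards [hball, self_mem_nhdsWithin] with z hz hz0
  exact subset_eigenSpan ⟨z, hz0, hz.ne, u, _,
    (h.mem_eigen_iff (isUnit_one_sub_smul hT hz)).2 ⟨rfl, rfl⟩⟩

theorem HasBlocks.map_eigenSpan_le {T : H →L[ℂ] H} {F : L₁ →L[ℂ] H} {G : H →L[ℂ] L₂}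
    {D : L₁ →L[ℂ] L₂} (h : HasBlocks Γ T F G D) (hT : ‖T‖ ≤ 1) {f : H} (hf : f ∈ eigenSpan Γ) :
    T f ∈ eigenSpan Γ := by
  have hle : eigenSpan Γ ≤ (eigenSpan Γ).comap (T : H →ₗ[ℂ] H) := by
    refine Submodule.topologicalClosure_minimal _ (Submodule.span_le.2 ?_)
      (isClosed_eigenSpan.preimage T.continuous)
    rintro g ⟨z, hz, hz1, u₁, u₂, hg⟩
    obtain ⟨e, -⟩ := (h _ _ _ _).1 hg
    -- The eigenvector equation `g = z T g + F u₁` expresses `T g` by vectors already in the span.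
    have e2 : T g = z⁻¹ • (g - F u₁) := by
      rw [eq_inv_smul_iff₀ hz, eq_sub_iff_add_eq, ← map_smul]
      exact e.symm
    change T g ∈ eigenSpan Γ
    rw [e2]
    exact Submodule.smul_mem _ _ (Submodule.sub_mem _ (subset_eigenSpan ⟨z, hz, hz1, u₁, u₂, hg⟩)
      (h.range_le_eigenSpan hT u₁))
  exact hle hf

variable [CompleteSpace L₁] [CompleteSpace L₂]

theorem _root_.IsUnitaryBoundaryPair.mem_eigenSpan_left {V : LinRel H H}
    (h : IsUnitaryBoundaryPair V Γ) {f f' : H} {u₁ : L₁} {u₂ : L₂}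
    (hf : ((f, f'), (u₁, u₂)) ∈ Γ) (hf' : f' ∈ eigenSpan Γ) : f ∈ eigenSpan Γ := by
  obtain ⟨T, F, G, D, hT, hB⟩ := h.exists_blocks
  replace hB : HasBlocks Γ T F G D := hB
  rw [((hB _ _ _ _).1 hf).1]
  exact Submodule.add_mem _ (hB.map_eigenSpan_le hT hf') (hB.range_le_eigenSpan hT u₁)

/-- The span is invariant in both directions, by `mem_eigenSpan_left` for `Γ` and for `flip Γ`, so
the restriction stays total on both sides. -/
theorem _root_.IsUnitaryBoundaryPair.restrict_eigenSpan {V : LinRel H H}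
    (h : IsUnitaryBoundaryPair V Γ) :
    IsUnitaryBoundaryPair (restrict Γ (eigenSpan Γ)).ker (restrict Γ (eigenSpan Γ)) := by
  refine (h.isConservative.restrict _).isUnitaryBoundaryPair ?_ ?_
  · rintro ⟨f', hf'⟩ u₁
    obtain ⟨f, u₂, hf⟩ := h.exists_left f' u₁
    exact ⟨⟨f, h.mem_eigenSpan_left hf hf'⟩, u₂, hf⟩
  · rintro ⟨f, hf⟩ u₂
    obtain ⟨f', u₁, hf'⟩ := h.flip.exists_left f u₂
    have := h.flip.mem_eigenSpan_left hf' (by rwa [eigenSpan_flip])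
    rw [eigenSpan_flip] at this
    exact ⟨⟨f', this⟩, u₁, hf'⟩

theorem _root_.IsUnitaryBoundaryPair.isSimple_restrict_eigenSpan {V : LinRel H H}
    (h : IsUnitaryBoundaryPair V Γ) : LinRel.IsSimple (restrict Γ (eigenSpan Γ)).ker := by
  have hN := h.restrict_eigenSpan
  refine ⟨fun z hz => hN.isometricOperator.norm_eq_one hz, ?_⟩
  have : CompleteSpace (eigenSpan Γ) := isClosed_eigenSpan.completeSpace_coe
  rw [Submodule.topologicalClosure_eq_top_iff, Submodule.eq_bot_iff]
  rintro ⟨x, hx⟩ hxo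
  -- Every eigenvector lies in a defect subspace, so `x` is orthogonal to the whole eigenvector
  -- span, which contains `x` itself.
  have hspan : Submodule.span ℂ (eigenvectors Γ) ≤ (ℂ ∙ x)ᗮ := by
    rw [Submodule.span_le]
    intro f hf
    have hfN := subset_eigenSpan hf
    obtain ⟨z, hz, hz1, u₁, u₂, hfz⟩ := hf
    have hmem : (⟨f, hfN⟩ : eigenSpan Γ) ∈
        ⨆ z ∈ {z : ℂ | ‖z‖ ≠ 1}, LinRel.defect (restrict Γ (eigenSpan Γ)).ker z :=
      Submodule.mem_iSup_of_mem z (Submodule.mem_iSup_of_mem hz1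
        (mem_defect_of_mem hN.green (u := (u₁, u₂)) hfz))
    exact Submodule.mem_orthogonal_singleton_iff_inner_left.2
      ((Submodule.mem_orthogonal _ _).1 hxo _ hmem)
  have hle : eigenSpan Γ ≤ (ℂ ∙ x)ᗮ :=
    Submodule.topologicalClosure_minimal _ hspan (Submodule.isClosed_orthogonal _)
  have := Submodule.mem_orthogonal_singleton_iff_inner_left.1 (hle hx)
  exact Subtype.ext (inner_self_eq_zero.1 this)

theorem _root_.IsUnitaryBoundaryPair.weylFamily_restrict_eigenSpan {V : LinRel H H}
    (h : IsUnitaryBoundaryPair V Γ) {z : ℂ} (hz : z ∈ unitDisk) :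
    weylFamily (restrict Γ (eigenSpan Γ)) z = weylFamily Γ z := by
  ext ⟨u₁, u₂⟩
  rw [mem_weylFamily, mem_weylFamily]
  constructor
  · rintro ⟨f, hf⟩
    exact ⟨f, hf⟩
  · rintro ⟨f, hf⟩
    refine ⟨⟨f, ?_⟩, hf⟩
    rcases eq_or_ne z 0 with rfl | h0
    · exact h.mem_eigenSpan_left hf (by simp)
    · exact subset_eigenSpan ⟨z, h0, ne_of_lt hz, u₁, u₂, hf⟩

end SimplePart

/-! ### Realization in the reproducing kernel space. -/

section Realization

variable [CompleteSpace L₁] [CompleteSpace L₂]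

/-- The kernel of a function on `Ω`, as an operator matrix. -/
def kernelMatrix (Ω : Set ℂ) (s : ℂ → L₁ →L[ℂ] L₂) : Matrix Ω Ω (L₂ →L[ℂ] L₂) :=
  .of fun z w => schurKernel s z w

theorem _root_.IsSchurKernelOn.posSemidef_kernelMatrix {Ω : Set ℂ} {s : ℂ → L₁ →L[ℂ] L₂}
    (hs : IsSchurKernelOn Ω s) : (kernelMatrix Ω s).PosSemidef := by
  have tfae := (RKHS.posSemidef_tfae (K := kernelMatrix Ω s)).out 0 2
  refine tfae.2 ⟨?_, fun v => ?_⟩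
  · ext z w f
    refine ext_inner_left ℂ fun g => ?_
    rw [Matrix.conjTranspose_apply, ContinuousLinearMap.star_eq_adjoint,
      ContinuousLinearMap.adjoint_inner_right, ← inner_conj_symm]
    exact inner_schurKernel_conj s _ _ _ _
  · let e := v.support.equivFin
    have h := (hs.posSemidef _ (fun i => ((e.symm i : Ω) : ℂ)) (fun i => v (e.symm i))
      fun i => (e.symm i : Ω).2).dotProduct_mulVec_nonneg (fun _ => 1)
    have h2 := (RCLike.nonneg_iff.1 h).1
    simp only [dotProduct, Matrix.mulVec, Matrix.of_apply, Pi.star_apply, star_one, one_mul,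
      mul_one] at h2
    have key : ∀ φ : Ω → Ω → ℂ, ∑ i, ∑ j, φ (e.symm i) (e.symm j) =
        ∑ z ∈ v.support, ∑ w ∈ v.support, φ z w := by
      intro φ
      rw [← Finset.sum_coe_sort v.support, ← e.symm.sum_comp]
      refine Finset.sum_congr rfl fun i _ => ?_
      rw [← Finset.sum_coe_sort v.support, ← e.symm.sum_comp]
    rw [key fun z w => inner ℂ (v z) (schurKernel s z w (v w)), Finset.sum_comm] at h2
    rw [← RCLike.conj_re]
    simpa [Finsupp.sum, kernelMatrix] using h2

/-- In the Green identity between `(f, z f)` and `(conj z • k, k)` the state terms cancel, which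
leaves `⟨A* v, u⟩ = ⟨v, Θ(z) u⟩`. -/
theorem weylFamily_isGraphOf_of_mem [CompleteSpace H] {V : LinRel H H}
    {Γ : LinRel (H × H) (L₁ × L₂)} (h : IsUnitaryBoundaryPair V Γ) {z : ℂ} (hz : z ∈ unitDisk)
    {A : L₁ →L[ℂ] L₂}
    (hA : ∀ v, ∃ k, ((conj z • k, k), (ContinuousLinearMap.adjoint A v, v)) ∈ Γ) :
    (weylFamily Γ z).IsGraphOf A := by
  obtain ⟨Θ, hΘ, -⟩ := exists_weylFunction h
  have hgraph := LinRel.isGraphOf_iff.1 (hΘ z hz)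
  have e : Θ z = A := by
    ext u
    refine ext_inner_left ℂ fun v => ?_
    obtain ⟨f, hf⟩ := mem_weylFamily.1 ((hgraph u (Θ z u)).2 rfl)
    obtain ⟨k, hk⟩ := hA v
    have := h.green _ hf _ hk
    simp only [GreenIdentity, inner_smul_left, inner_smul_right, Complex.conj_conj, sub_self,
      ContinuousLinearMap.adjoint_inner_left] at this
    exact (sub_eq_zero.1 this.symm).symm
  exact e ▸ hΘ z hz

end Realization

end BoundaryPair

open BoundaryPair in
/-- Every function with a nonnegative Schur kernel is the Weyl function of a unitary boundary pair
for a simple isometric operator. -/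
theorem IsSchurKernelOn.exists_realization
    {L₁ : Type u} [NormedAddCommGroup L₁] [InnerProductSpace ℂ L₁] [CompleteSpace L₁]
    {L₂ : Type v} [NormedAddCommGroup L₂] [InnerProductSpace ℂ L₂] [CompleteSpace L₂]
    {Ω : Set ℂ} {s : ℂ → L₁ →L[ℂ] L₂} (hΩ : Ω ⊆ unitDisk) (hs : IsSchurKernelOn Ω s) :
    ∃ (H : Type (max u v)) (_ : NormedAddCommGroup H) (_ : InnerProductSpace ℂ H)
      (_ : CompleteSpace H) (V : LinRel H H) (Γ : LinRel (H × H) (L₁ × L₂)),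
      IsUnitaryBoundaryPair V Γ ∧ V.IsSimple ∧
      ∀ z ∈ Ω, (BoundaryPair.weylFamily Γ z).IsGraphOf (s z) := by
  have : Fact (kernelMatrix Ω s).PosSemidef := ⟨hs.posSemidef_kernelMatrix⟩
  let K := RKHS.OfKernel (kernelMatrix Ω s)
  let k : Ω → L₂ →L[ℂ] K := RKHS.kerFun K
  have hk : ∀ (z w : Ω) (f g : L₂), inner ℂ (k z f) (k w g) =
      inner ℂ f (schurKernel s z w g) := by
    intro z w f g
    rw [← ContinuousLinearMap.adjoint_inner_right]
    change inner ℂ f ((ContinuousLinearMap.adjoint (RKHS.kerFun K z) ∘L RKHS.kerFun K w) g) = _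
    rw [← RKHS.kernel_apply, RKHS.OfKernel.kernel_ofKernel]
    rfl
  let S : Set ((K × K) × (L₁ × L₂)) := Set.range fun p : Ω × L₂ =>
    ((conj (p.1 : ℂ) • k p.1 p.2, k p.1 p.2),
      (ContinuousLinearMap.adjoint (s p.1) p.2, p.2))
  have hS : ∀ p ∈ S, ∀ q ∈ S, GreenIdentity p q := by
    rintro _ ⟨⟨w, g⟩, rfl⟩ _ ⟨⟨z, f⟩, rfl⟩
    have hne : 1 - (z : ℂ) * conj (w : ℂ) ≠ 0 :=
      one_sub_mul_conj_ne_zero (le_of_lt (hΩ z.2)) (hΩ w.2)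
    simp only [GreenIdentity, inner_smul_left, inner_smul_right, hk, Complex.conj_conj,
      schurKernel, ContinuousLinearMap.adjoint_inner_left, FunLike.coe_smul, Pi.smul_apply,
      FunLike.coe_sub, Pi.sub_apply, inner_sub_right, ContinuousLinearMap.comp_apply,
      ContinuousLinearMap.id_apply]
    -- The Green identity is the kernel formula multiplied by its denominator `1 - z conj w`.
    linear_combination (inner ℂ f (s z (ContinuousLinearMap.adjoint (s w) g)) - inner ℂ f g) *
      mul_inv_cancel₀ hne
  let Γ₀ := (Submodule.span ℂ S).topologicalClosure
  have hcons : IsConservative Γ₀ := isConservative_of_green (green_topologicalClosure_span hS)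
  have hU := hcons.isUnitaryBoundaryPair_unitaryExtension
    (Submodule.isClosed_topologicalClosure _)
  have : CompleteSpace (eigenSpan (unitaryExtension Γ₀)) := isClosed_eigenSpan.completeSpace_coe
  refine ⟨eigenSpan (unitaryExtension Γ₀), inferInstance, inferInstance, inferInstance, _, _,
    hU.restrict_eigenSpan, hU.isSimple_restrict_eigenSpan, fun z hz => ?_⟩
  rw [hU.weylFamily_restrict_eigenSpan (hΩ hz)]
  refine weylFamily_isGraphOf_of_mem hU (hΩ hz) fun v => ⟨toExtension Γ₀ (k ⟨z, hz⟩ v), ?_⟩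
  have hmem := mem_unitaryExtension (Submodule.le_topologicalClosure _
    (Submodule.subset_span ⟨(⟨z, hz⟩, v), rfl⟩) : _ ∈ Γ₀)
  convert hmem using 3
  simp [toExtension, ← WithLp.toLp_smul]

end

theorem mainTheorem7
    {L₁ : Type u} [NormedAddCommGroup L₁] [InnerProductSpace ℂ L₁] [CompleteSpace L₁]
    {L₂ : Type v} [NormedAddCommGroup L₂] [InnerProductSpace ℂ L₂] [CompleteSpace L₂] :
    -- the direct part
    (∀ (H : Type w) [NormedAddCommGroup H] [InnerProductSpace ℂ H] [CompleteSpace H]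
        (V : LinRel H H) (Γ : LinRel (H × H) (L₁ × L₂)),
      IsUnitaryBoundaryPair V Γ →
      -- (i) the inverse of `V₁` and `V₂` are everywhere defined contractions, `V₂ = V₁^{-*}`
      ((∃ T₁ : H →L[ℂ] H, (BoundaryPair.ext₁ Γ).inv.IsGraphOf T₁ ∧ ‖T₁‖ ≤ 1) ∧
        (∃ T₂ : H →L[ℂ] H, (BoundaryPair.ext₂ Γ).IsGraphOf T₂ ∧ ‖T₂‖ ≤ 1) ∧
        BoundaryPair.ext₂ Γ = (BoundaryPair.ext₁ Γ).inv.adjoint) ∧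
      -- (ii) the first gamma-field
      (∃ γ₁ : ℂ → L₁ →L[ℂ] H,
        (∀ z ∈ unitDisk, (BoundaryPair.gammaField₁ Γ z).IsGraphOf (γ₁ z)) ∧
        DifferentiableOn ℂ γ₁ unitDisk ∧
        ∀ z ∈ unitDisk, ∃ R : H →L[ℂ] H, (BoundaryPair.ext₁ Γ).IsResolventAt z R ∧
          ∀ μ ∈ unitDisk, γ₁ z = γ₁ μ + (z - μ) • R.comp (γ₁ μ)) ∧
      -- (iii) the second gamma-field
      (∃ γ₂ : ℂ → L₂ →L[ℂ] H,
        (∀ z ∈ exteriorDisk, (BoundaryPair.gammaField₂ Γ z).IsGraphOf (γ₂ z)) ∧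
        DifferentiableOn ℂ γ₂ exteriorDisk ∧
        ∀ z ∈ exteriorDisk, ∃ R : H →L[ℂ] H, (BoundaryPair.ext₂ Γ).IsResolventAt z R ∧
          ∀ μ ∈ exteriorDisk, γ₂ z = γ₂ μ + (z - μ) • R.comp (γ₂ μ)) ∧
      -- (iv) the Weyl function is a Schur function
      (∃ Θ : ℂ → L₁ →L[ℂ] L₂,
        (∀ z ∈ unitDisk, (BoundaryPair.weylFamily Γ z).IsGraphOf (Θ z)) ∧
        IsSchur Θ ∧ IsSchurKernelOn unitDisk Θ)) ∧
    -- the converse, for Schur functions on the unit disk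
    (∀ s : ℂ → L₁ →L[ℂ] L₂, IsSchur s →
      ∃ (H : Type (max u v)) (_ : NormedAddCommGroup H) (_ : InnerProductSpace ℂ H)
        (_ : CompleteSpace H) (V : LinRel H H) (Γ : LinRel (H × H) (L₁ × L₂)),
        IsUnitaryBoundaryPair V Γ ∧ V.IsSimple ∧
        ∀ z ∈ unitDisk, (BoundaryPair.weylFamily Γ z).IsGraphOf (s z)) ∧
    -- the converse, for functions given on an open part of the disk, with a nonnegative kernel
    (∀ (Ω : Set ℂ) (s : ℂ → L₁ →L[ℂ] L₂), IsOpen Ω → Ω.Nonempty → Ω ⊆ unitDisk →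
      IsSchurKernelOn Ω s →
      ∃ (H : Type (max u v)) (_ : NormedAddCommGroup H) (_ : InnerProductSpace ℂ H)
        (_ : CompleteSpace H) (V : LinRel H H) (Γ : LinRel (H × H) (L₁ × L₂)),
        IsUnitaryBoundaryPair V Γ ∧ V.IsSimple ∧
        ∀ z ∈ Ω, (BoundaryPair.weylFamily Γ z).IsGraphOf (s z)) := by
  refine ⟨fun H _ _ _ V Γ h => ⟨BoundaryPair.extensions_properties h,
    BoundaryPair.gammaField₁_properties h, BoundaryPair.gammaField₂_properties h, ?_⟩,
    fun s hs => hs.isSchurKernelOn.exists_realization subset_rfl,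
    fun Ω s _ _ hΩ hs => hs.exists_realization hΩ⟩
  obtain ⟨Θ, hΘ, hS⟩ := BoundaryPair.exists_weylFunction h
  exact ⟨Θ, hΘ, hS, hS.isSchurKernelOn⟩
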